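/- Let $\mathcal C$ be a semi-abelian category (pointed, Barr exact, protomodular, with finite coproducts). For objects $B,X$ let $\kappa_{B,X}\colon B\flat X\to B+X$ be the kernel of $[1,0]\colon B+X\to B$. An (internal) action of $B$ on $X$ is an algebra structure $\xi\colon B\flat X\to X$ for the monad $B\flat(-)$, and the conjugation action $\chi\colon B\flat B\to B$ is the restriction of $[1,1]\colon B+B\to B$. A pre-crossed module over $B$ is a morphism $\delta\colon X\to B$ with an action $\xi$ of $B$ on $X$ such that $\delta\xi=\chi(1\flat\delta)$; with the equivariant morphisms over $B$ these form the category $\mathrm{PXMod}_B(\mathcal C)$, whose coproduct is written $+_{\mathrm{PX}}$. Assume condition (CS): for every $B$ and all $X,Y$ in $\mathrm{PXMod}_B(\mathcal C)$ the comparison $\sigma\colon X+Y\to X+_{\mathrm{PX}}Y$ is a regular epimorphism in $\mathcal C$. Let $(\delta_X\colon X\to B,\xi_X)$ and $(\delta_Y\colon Y\to B,\xi_Y)$ be pre-crossed modules. Then $Y$ acts on $X$ by $\delta_Y^*\xi_X=\xi_X(\delta_Y\flat 1)$, and $X$ acts on $Y$ by $\delta_X^*\xi_Y=\xi_Y(\delta_X\flat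 1)$. The semidirect product $X\rtimes Y$, with $j_X\colon X\to X\rtimes Y$ and $i_Y\colon Y\to X\rtimes Y$, is the pushout of $\kappa_{Y,X}\colon Y\flat X\to X+Y$ along $\delta_Y^*\xi_X$. It is a pre-crossed module over $B$ with structure morphism restricting to $\delta_X$ on $X$ and to $\delta_Y$ on $Y$, and with the action of $B$ obtained by restricting along $B\to X\rtimes B$ the action of $X\rtimes B$ on the pullback $X\rtimes Y=(X\rtimes B)\times_B Y$ whose components are the conjugation action of $X\rtimes B$ on itself and the action on $Y$ through $X\rtimes B\to B$; the morphisms $j_X,i_Y$ are then morphisms of pre-crossed modules. Symmetrically one has $Y\rtimes X$ with $i_X\colon X\to Y\rtimes X$ and $j_Y\colon Y\to Y\rtimes X$. The Peiffer product $X\bowtie Y$ is the pushout in $\mathrm{PXMod}_B(\mathcal C)$ of the canonical morphisms $X+_{\mathrm{PX}}Y\to X\rtimes Y$ and $X+_{\mathrm{PX}}Y\to Y\rtimes X$; let $l_X,l_Y$ be the canonical morphisms from $X$ and $Y$ to it. Then the Peiffer product $X\bowtie Y$ (with all the data above) exists, and: 1. $X\bowtie Y$ is the quotient, in $\mathcal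 C$, of the coproduct $X+Y$ by the join $J$ of the subobjects $\ker([j_X,i_Y]\colon X+Y\to X\rtimes Y)$ and $\ker([i_X,j_Y]\colon X+Y\to Y\rtimes X)$ of $X+Y$. That is, $q=[l_X,l_Y]\colon X+Y\to X\bowtie Y$ is a regular epimorphism, it is the cokernel of the inclusion of $J$ in $X+Y$, and $J$ is its kernel. 2. $q$ is the universal quotient of $X+Y$ in which both induced actions become conjugations: writing $\iota_X,\iota_Y$ for the coproduct injections and regarding $\kappa_{Y,X}$ and $\kappa_{X,Y}$ as morphisms to $X+Y$, one has $$q\,\kappa_{Y,X}=q\,\iota_X\,(\delta_Y^*\xi_X),\qquad q\,\kappa_{X,Y}=q\,\iota_Y\,(\delta_X^*\xi_Y),$$ and every morphism $h\colon X+Y\to Z$ in $\mathcal C$ satisfying the same two equations (with $h$ in place of $q$) factors uniquely through $q$. In particular $X\bowtie Y$ is described by constructions in $\mathcal C$ that do not involve the coproduct $+_{\mathrm{PX}}$. -/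

import Mathlib

open CategoryTheory CategoryTheory.Limits

universe v u

namespace Peiffer

/-- A semi-abelian category (Janelidze, Márki, Tholen): a pointed category with finite coproducts
which is Barr exact (regular, and every internal equivalence relation is a kernel pair) and
protomodular (for pointed categories with kernels: the split short five lemma holds). -/
class SemiAbelian (C : Type u) [Category.{v} C] [HasZeroMorphisms C] : Prop extends
    Regular C, HasZeroObject C where
  hasFiniteCoproducts : HasFiniteCoproducts C
  exact : ∀ {R A : C} (p₁ p₂ : R ⟶ A), IsEquivalenceRelation p₁ p₂ →
    ∃ (Q : C) (q : A ⟶ Q), IsKernelPair q p₁ p₂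
  splitShortFive : ∀ {E E' B : C} (p : E ⟶ B) (s : B ⟶ E) (p' : E' ⟶ B) (s' : B ⟶ E')
    (f : E ⟶ E') (_ : s ≫ p = 𝟙 B) (_ : s' ≫ p' = 𝟙 B) (hp : p ≫ 𝟙 B = f ≫ p')
    (_ : s ≫ f = s'), IsIso (kernel.map p p' f (𝟙 B) hp) → IsIso f

variable {C : Type u} [Category.{v} C] [HasZeroMorphisms C] [SemiAbelian C]

instance : HasFiniteCoproducts C := SemiAbelian.hasFiniteCoproducts

/-- `B ♭ X`, the kernel of `[1, 0] : B + X ⟶ B`. -/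
noncomputable def flat (B X : C) : C := kernel (coprod.desc (𝟙 B) (0 : X ⟶ B))

/-- The kernel inclusion `B ♭ X ⟶ B + X`. -/
noncomputable def flatι (B X : C) : flat B X ⟶ B ⨿ X := kernel.ι (coprod.desc (𝟙 B) (0 : X ⟶ B))

theorem flatι_desc (B X : C) : flatι B X ≫ coprod.desc (𝟙 B) (0 : X ⟶ B) = 0 :=
  kernel.condition _

noncomputable def flatLift {B X Z : C} (h : Z ⟶ B ⨿ X)
    (w : h ≫ coprod.desc (𝟙 B) (0 : X ⟶ B) = 0) : Z ⟶ flat B X :=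
  kernel.lift _ h w

@[simp]
theorem flatLift_ι {B X Z : C} (h : Z ⟶ B ⨿ X)
    (w : h ≫ coprod.desc (𝟙 B) (0 : X ⟶ B) = 0) : flatLift h w ≫ flatι B X = h :=
  kernel.lift_ι _ _ _

theorem flat_hom_ext {B X Z : C} {f g : Z ⟶ flat B X}
    (h : f ≫ flatι B X = g ≫ flatι B X) : f = g :=
  equalizer.hom_ext h

/-- The bifunctor `♭` on morphisms: `f ♭ g : B ♭ X ⟶ B' ♭ X'`, the restriction of `f + g`. -/
noncomputable def flatMap {B B' X X' : C} (f : B ⟶ B') (g : X ⟶ X') : flat B X ⟶ flat B' X' :=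
  flatLift (flatι B X ≫ coprod.map f g) (by
    have h : coprod.map f g ≫ coprod.desc (𝟙 B') (0 : X' ⟶ B') =
        coprod.desc (𝟙 B) (0 : X ⟶ B) ≫ f := by ext <;> simp
    rw [Category.assoc, h, ← Category.assoc, flatι_desc, zero_comp])

@[simp]
theorem flatMap_ι {B B' X X' : C} (f : B ⟶ B') (g : X ⟶ X') :
    flatMap f g ≫ flatι B' X' = flatι B X ≫ coprod.map f g :=
  flatLift_ι _ _

theorem flatMap_id (B X : C) : flatMap (𝟙 B) (𝟙 X) = 𝟙 (flat B X) := by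
  apply flat_hom_ext
  simp

theorem flatMap_comp {B B' B'' X X' X'' : C} (f : B ⟶ B') (f' : B' ⟶ B'') (g : X ⟶ X')
    (g' : X' ⟶ X'') : flatMap f g ≫ flatMap f' g' = flatMap (f ≫ f') (g ≫ g') := by
  apply flat_hom_ext
  rw [Category.assoc, flatMap_ι, ← Category.assoc, flatMap_ι, flatMap_ι, Category.assoc,
    coprod.map_map]

/-- The unit `X ⟶ B ♭ X` of the monad `B ♭ -`, induced by the injection of `X` in `B + X`. -/
noncomputable def flatUnit (B X : C) : X ⟶ flat B X :=
  flatLift coprod.inr (coprod.inr_desc _ _)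

/-- The multiplication `B ♭ (B ♭ X) ⟶ B ♭ X` of the monad `B ♭ -`, the restriction of the
morphism `B + (B ♭ X) ⟶ B + X` with components the injection of `B` and the kernel inclusion. -/
noncomputable def flatMul (B X : C) : flat B (flat B X) ⟶ flat B X :=
  flatLift (flatι B (flat B X) ≫ coprod.desc coprod.inl (flatι B X)) (by
    have h : coprod.desc coprod.inl (flatι B X) ≫ coprod.desc (𝟙 B) (0 : X ⟶ B) =
        coprod.desc (𝟙 B) (0 : flat B X ⟶ B) := by
      ext
      · rw [← Category.assoc, coprod.inl_desc, coprod.inl_desc, coprod.inl_desc]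
      · rw [← Category.assoc, coprod.inr_desc, coprod.inr_desc, flatι_desc]
    rw [Category.assoc, h, flatι_desc])

/-- The conjugation action of `B` on itself, the restriction of `[1, 1] : B + B ⟶ B`. -/
noncomputable def conj (B : C) : flat B B ⟶ B := flatι B B ≫ coprod.desc (𝟙 B) (𝟙 B)

/-- An internal pre-crossed module over `B`: an internal action `act` of `B` on `obj`
(an algebra for the monad `B ♭ -`), and a morphism `δ : obj ⟶ B` which is equivariant for this
action and the conjugation action of `B` on itself. -/
structure PXMod (B : C) where
  obj : C
  δ : obj ⟶ B
  act : flat B obj ⟶ obj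
  act_unit : flatUnit B obj ≫ act = 𝟙 obj
  act_mul : flatMul B obj ≫ act = flatMap (𝟙 B) act ≫ act
  precrossed : act ≫ δ = flatMap (𝟙 B) δ ≫ conj B

/-- Morphisms of pre-crossed modules over `B`: equivariant morphisms over `B`. -/
@[ext]
structure PXMod.Hom {B : C} (X Y : PXMod B) where
  hom : X.obj ⟶ Y.obj
  comp_δ : hom ≫ Y.δ = X.δ
  act_comp : X.act ≫ hom = flatMap (𝟙 B) hom ≫ Y.act

/-- The category of internal pre-crossed modules over `B`. -/
instance (B : C) : Category (PXMod B) where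
  Hom X Y := PXMod.Hom X Y
  id X := ⟨𝟙 X.obj, by simp, by simp [flatMap_id]⟩
  comp {X Y Z} f g := ⟨f.hom ≫ g.hom, by rw [Category.assoc, g.comp_δ, f.comp_δ], by
    rw [← Category.assoc, f.act_comp, Category.assoc, g.act_comp, ← Category.assoc, flatMap_comp,
      Category.comp_id]⟩
  id_comp f := PXMod.Hom.ext (Category.id_comp f.hom)
  comp_id f := PXMod.Hom.ext (Category.comp_id f.hom)
  assoc f g h := PXMod.Hom.ext (Category.assoc f.hom g.hom h.hom)

/-- Condition (CS): for all pre-crossed modules `X`, `Y` over the same object, the comparison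
morphism `σ : X + Y ⟶ X +_PX Y` from the coproduct in `C` to (the object underlying) the coproduct
of pre-crossed modules is a regular epimorphism. -/
def ConditionCS (C : Type u) [Category.{v} C] [HasZeroMorphisms C] [SemiAbelian C] : Prop :=
  ∀ (B : C) (X Y : PXMod B) (c : BinaryCofan X Y), IsColimit c →
    IsRegularEpi
      (coprod.desc (PXMod.Hom.hom c.inl) (PXMod.Hom.hom c.inr) : X.obj ⨿ Y.obj ⟶ c.pt.obj)

/-- `S`, with `j : X ⟶ S` and `i : G ⟶ S`, is the semidirect product `X ⋊ G` for the action `ξ`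
of `G` on `X`: the pushout of `ξ` along the inclusion of `G ♭ X` in the coproduct. -/
def IsSemidirect {G X S : C} (ξ : flat G X ⟶ X) (j : X ⟶ S) (i : G ⟶ S) : Prop :=
  IsPushout (flatι G X) ξ (coprod.desc i j) j

/-- For pre-crossed modules `X`, `Y` over `B`, the action `δ_Y^* ξ_X` of `Y` on `X` induced by
the action of `B` on `X` along `δ_Y`. -/
noncomputable def inducedAct {B : C} (X Y : PXMod B) : flat Y.obj X.obj ⟶ X.obj :=
  flatMap Y.δ (𝟙 X.obj) ≫ X.act

/-- A semidirect product `X ⋊ Y` of pre-crossed modules over `B`, as a pre-crossed module over `B`.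

The underlying object is the semidirect product for `δ_Y^* ξ_X`, and its structure morphism to `B`
is `[δ_X, δ_Y⟩`, the one restricting to `δ_X` and `δ_Y` (which is part of `j`, `i` being
morphisms over `B`).  The action of `B` is obtained as follows.  Let `W = X ⋊ B`, with projection
`pB : X ⋊ B ⟶ B`, let `pY : X ⋊ Y ⟶ Y` be the projection and `t = 1 ⋊ δ_Y : X ⋊ Y ⟶ X ⋊ B`; the
square `pY ≫ δ_Y = t ≫ pB` is a pullback.  Then `X ⋊ B` acts on `X ⋊ Y` by the pullback action
`wact`, the one whose components along `pY` and `t` are `ξ_Y ∘ (pB ♭ pY)` and `χ ∘ (1 ♭ t)`, and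
the action of `B` is the restriction of `wact` along `iB : B ⟶ X ⋊ B`. -/
structure SemidirectPXMod {B : C} (X Y : PXMod B) where
  S : PXMod B
  j : X ⟶ S
  i : Y ⟶ S
  isSemidirect : IsSemidirect (inducedAct X Y) j.hom i.hom
  pY : S.obj ⟶ Y.obj
  j_pY : j.hom ≫ pY = 0
  i_pY : i.hom ≫ pY = 𝟙 Y.obj
  W : C
  jW : X.obj ⟶ W
  iB : B ⟶ W
  isSemidirectW : IsSemidirect X.act jW iB
  pB : W ⟶ B
  jW_pB : jW ≫ pB = 0
  iB_pB : iB ≫ pB = 𝟙 B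
  t : S.obj ⟶ W
  j_t : j.hom ≫ t = jW
  i_t : i.hom ≫ t = Y.δ ≫ iB
  wact : flat W S.obj ⟶ S.obj
  wact_pY : wact ≫ pY = flatMap pB pY ≫ Y.act
  wact_t : wact ≫ t = flatMap (𝟙 W) t ≫ conj W
  act_eq : S.act = flatMap iB (𝟙 S.obj) ≫ wact

/-- A Peiffer product `X ⋈ Y` of pre-crossed modules over `B`: the pushout, in the category of
pre-crossed modules over `B`, of the canonical morphisms from the coproduct `X +_PX Y` of
pre-crossed modules to the semidirect products `X ⋊ Y` and `Y ⋊ X`. -/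
structure PeifferProduct {B : C} (X Y : PXMod B) where
  coproduct : BinaryCofan X Y
  isColimit : IsColimit coproduct
  left : SemidirectPXMod X Y
  right : SemidirectPXMod Y X
  toLeft : coproduct.pt ⟶ left.S
  inl_toLeft : coproduct.inl ≫ toLeft = left.j
  inr_toLeft : coproduct.inr ≫ toLeft = left.i
  toRight : coproduct.pt ⟶ right.S
  inl_toRight : coproduct.inl ≫ toRight = right.i
  inr_toRight : coproduct.inr ≫ toRight = right.j
  pt : PXMod B
  fromLeft : left.S ⟶ pt
  fromRight : right.S ⟶ pt
  isPushout : IsPushout toLeft toRight fromLeft fromRight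

namespace PeifferProduct

variable {B : C} {X Y : PXMod B} (D : PeifferProduct X Y)

/-- The canonical morphism `l_X : X ⟶ X ⋈ Y`. -/
def lX : X ⟶ D.pt := D.coproduct.inl ≫ D.toLeft ≫ D.fromLeft

/-- The canonical morphism `l_Y : Y ⟶ X ⋈ Y`. -/
def lY : Y ⟶ D.pt := D.coproduct.inr ≫ D.toLeft ≫ D.fromLeft

/-- The canonical morphism `[l_X, l_Y] : X + Y ⟶ X ⋈ Y` from the coproduct in `C`. -/
noncomputable def proj : X.obj ⨿ Y.obj ⟶ D.pt.obj := coprod.desc D.lX.hom D.lY.hom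

/-- The join, among subobjects of the coproduct `X + Y` in `C`, of the kernels of the canonical
morphisms `X + Y ⟶ X ⋊ Y` and `X + Y ⟶ Y ⋊ X`. -/
noncomputable def kernelJoin : Subobject (X.obj ⨿ Y.obj) :=
  kernelSubobject (coprod.desc D.left.j.hom D.left.i.hom) ⊔
    kernelSubobject (coprod.desc D.right.i.hom D.right.j.hom)

end PeifferProduct

/-- `h : X + Y ⟶ Z` turns the induced actions of `Y` on `X` and of `X` on `Y` into conjugations:
it identifies the formal conjugates of `Y` on `X` (the inclusion of `Y ♭ X` in `X + Y`) with the
values of the action `δ_Y^* ξ_X`, and symmetrically. -/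
def ActionsBecomeConj {B : C} (X Y : PXMod B) {Z : C} (h : X.obj ⨿ Y.obj ⟶ Z) : Prop :=
  (flatι Y.obj X.obj ≫ coprod.desc coprod.inr coprod.inl) ≫ h =
      (inducedAct X Y ≫ coprod.inl) ≫ h ∧
    flatι X.obj Y.obj ≫ h = (inducedAct Y X ≫ coprod.inr) ≫ h

end Peiffer

open Peiffer

/-!
The proof works with exact forks `A ⇉ E ⟶ Q`: regular epimorphisms whose kernel pair is covered by
`A`. By protomodularity relations are difunctional (`maltsev`), so in an exact category every pair
which is reflexive up to a cover has an exact quotient (`exists_isExactFork`). Exact forks are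
coequalizers which are stable under restriction to the kernels of morphisms to a fixed object, so
that each functor `B ♭ -` preserves them (`IsExactFork.flatMap`). Three consequences carry the
existence of the Peiffer product:

* a compatible exact quotient of a pre-crossed module is one again (`PXMod.exists_quotient`), and
  so coproducts of pre-crossed modules exist, as quotients of free ones, and pushouts of regular
  epimorphisms of pre-crossed modules exist and are computed in the base category;
* the semidirect product of an action is a split extension (`IsAction.exists_isSemidirect`);
* by the split short five lemma `X ⋊ Y` is the pullback of `X ⋊ B` and `Y` over `B`, which gives
  the action of `B` on it (`nonempty_semidirectPXMod`).

For an arbitrary Peiffer product, `X ⋊ Y` is by definition the universal quotient of `X + Y` in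
which the action of `Y` on `X` becomes a conjugation, and likewise for `Y ⋊ X`. Under (CS) the
comparison from `X + Y` to the coproduct of pre-crossed modules is epic, so that the Peiffer product
is the pushout in the base category of these two quotients of `X + Y`
(`PeifferProduct.isPushout_proj`). This is the universal property. The kernel of the diagonal of
such a pushout is the join of the two kernels: its elements are joined to `0` by a chain of
relations in the two kernel pairs, and a subobject containing the kernel of a morphism is saturated
for its kernel pair (`exists_factor_of_kernel`, `exists_factor_kernel_of_isPushout`). Finally
regular epimorphisms are cokernels of their kernels.
-/

set_option linter.unusedSectionVars false

namespace Peiffer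

variable {C : Type u} [Category.{v} C] [HasZeroMorphisms C] [SemiAbelian C]

attribute [local simp] pullback.lift_fst pullback.lift_fst_assoc pullback.lift_snd
  pullback.lift_snd_assoc prod.lift_fst prod.lift_fst_assoc prod.lift_snd prod.lift_snd_assoc
  coprod.inl_desc coprod.inl_desc_assoc coprod.inr_desc coprod.inr_desc_assoc
  equalizer.lift_ι equalizer.lift_ι_assoc kernel.lift_ι kernel.lift_ι_assoc

/-! ### Protomodularity -/

/-- In a split extension the section and the kernel are jointly extremally epic: a subobject
containing both is everything. -/
theorem isIso_of_mono_of_split {M E B : C} (m : M ⟶ E) [Mono m] (p : E ⟶ B) (s : B ⟶ E)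
    (hs : s ≫ p = 𝟙 B) (s' : B ⟶ M) (hs' : s' ≫ m = s) (k : kernel p ⟶ M)
    (hk : k ≫ m = kernel.ι p) : IsIso m := by
  refine SemiAbelian.splitShortFive (m ≫ p) s' p s m (by rw [← Category.assoc, hs', hs]) hs
    (Category.comp_id _) hs' ⟨kernel.lift (m ≫ p) k ?_, ?_, ?_⟩
  · rw [← Category.assoc, hk, kernel.condition]
  · rw [← cancel_mono (kernel.ι (m ≫ p)), ← cancel_mono m]
    simp [hk]
  · rw [← cancel_mono (kernel.ι p)]
    simp [hk]

theorem exists_factor_of_split {M N E B : C} (m : M ⟶ N) [Mono m] (p : E ⟶ B) (s : B ⟶ E)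
    (hs : s ≫ p = 𝟙 B) (φ : E ⟶ N) (h₁ : ∃ a, a ≫ m = s ≫ φ)
    (h₂ : ∃ a, a ≫ m = kernel.ι p ≫ φ) : ∃ a, a ≫ m = φ := by
  obtain ⟨a, ha⟩ := h₁
  obtain ⟨b, hb⟩ := h₂
  have : IsIso (pullback.snd m φ) :=
    isIso_of_mono_of_split _ p s hs (pullback.lift a s ha) (by simp)
      (pullback.lift b (kernel.ι p) hb) (by simp)
  exact ⟨inv (pullback.snd m φ) ≫ pullback.fst m φ, by simp [pullback.condition]⟩

theorem hom_ext_of_split {N E B : C} (p : E ⟶ B) (s : B ⟶ E) (hs : s ≫ p = 𝟙 B) (φ ψ : E ⟶ N)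
    (h₁ : s ≫ φ = s ≫ ψ) (h₂ : kernel.ι p ≫ φ = kernel.ι p ≫ ψ) : φ = ψ := by
  obtain ⟨a, ha⟩ := exists_factor_of_split (equalizer.ι φ ψ) p s hs (𝟙 E)
    ⟨equalizer.lift s h₁, by simp⟩ ⟨equalizer.lift (kernel.ι p) h₂, by simp⟩
  rw [← Category.id_comp φ, ← Category.id_comp ψ, ← ha, Category.assoc, Category.assoc,
    equalizer.condition]

/-- A subobject containing the kernel of `f` is saturated for the kernel pair of `f`. -/
theorem exists_factor_of_kernel {J E S T : C} (m : J ⟶ E) [Mono m] (f : E ⟶ S)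
    (hf : ∃ a, a ≫ m = kernel.ι f) (x y : T ⟶ E) (hxy : x ≫ f = y ≫ f)
    (hx : ∃ a, a ≫ m = x) : ∃ a, a ≫ m = y := by
  obtain ⟨k, hk⟩ := hf
  obtain ⟨a, rfl⟩ := hx
  -- In `{(b, z) | b ∈ J, f b = f z}` the diagonal copy of `J` and the kernel of `f` both have
  -- their second component in `J`.
  obtain ⟨l, hl⟩ := exists_factor_of_split m (pullback.fst (m ≫ f) f)
    (pullback.lift (𝟙 J) m (by simp)) (by simp) (pullback.snd (m ≫ f) f) ⟨𝟙 J, by simp⟩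
    ⟨kernel.lift f (kernel.ι _ ≫ pullback.snd _ _) (by
      rw [Category.assoc, ← pullback.condition, kernel.condition_assoc, zero_comp]) ≫ k, by
      rw [Category.assoc, hk, kernel.lift_ι]⟩
  exact ⟨pullback.lift a y (by simpa using hxy) ≫ l, by rw [Category.assoc, hl, pullback.lift_snd]⟩

/-- A regular epimorphism is the cokernel of its kernel. -/
theorem exists_desc_of_kernel {E S Z : C} (f : E ⟶ S) [IsRegularEpi f] (h : E ⟶ Z)
    (hh : kernel.ι f ≫ h = 0) : ∃ l, f ≫ l = h := by
  refine IsRegularEpi.exists_of_isKernelPair f (IsKernelPair.of_hasPullback f) h ?_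
  refine hom_ext_of_split (pullback.fst f f) (pullback.lift (𝟙 E) (𝟙 E) rfl) (by simp) _ _
    (by simp) ?_
  have h₁ : (kernel.ι (pullback.fst f f) ≫ pullback.snd f f) ≫ f = 0 := by
    rw [Category.assoc, ← pullback.condition, kernel.condition_assoc, zero_comp]
  rw [kernel.condition_assoc, zero_comp, ← Category.assoc, ← kernel.lift_ι f _ h₁, Category.assoc,
    hh, comp_zero]

/-- Relations are difunctional: if `a = (x, y)`, `b = (x, y')` and `c = (x', y')` are in the
relation `(r₁, r₂)`, then so is `(x', y)`. This is the Mal'tsev property. -/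
theorem maltsev {R X X' T : C} (r₁ : R ⟶ X) (r₂ : R ⟶ X') [JointlyMono₂ r₁ r₂] (a b c : T ⟶ R)
    (hab : a ≫ r₁ = b ≫ r₁) (hbc : b ≫ r₂ = c ≫ r₂) :
    ∃ d : T ⟶ R, d ≫ r₁ = c ≫ r₁ ∧ d ≫ r₂ = a ≫ r₂ := by
  have : Mono (prod.lift r₁ r₂) := ⟨fun f g h ↦ JointlyMono₂.right_cancellation (p₁ := r₁)
    (p₂ := r₂) f g (by simpa using h =≫ prod.fst) (by simpa using h =≫ prod.snd)⟩
  -- `E` is the object of triples `(a, b, c)` as in the statement; it is a split epimorphism over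
  -- the object of pairs `(a, b)`, the section being `(a, b) ↦ (a, b, b)`, and its kernel consists
  -- of the triples `(0, 0, c)`.
  let p := pullback.fst (pullback.snd r₁ r₁) (pullback.fst r₂ r₂)
  let p' := pullback.snd (pullback.snd r₁ r₁) (pullback.fst r₂ r₂)
  have hp : p ≫ pullback.snd r₁ r₁ = p' ≫ pullback.fst r₂ r₂ := pullback.condition
  let s : pullback r₁ r₁ ⟶ pullback (pullback.snd r₁ r₁) (pullback.fst r₂ r₂) :=
    pullback.lift (𝟙 _) (pullback.snd r₁ r₁ ≫ pullback.lift (𝟙 R) (𝟙 R) rfl) (by simp)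
  have hs : s ≫ p = 𝟙 _ := by simp [s, p]
  have hs' : s ≫ p' = pullback.snd r₁ r₁ ≫ pullback.lift (𝟙 R) (𝟙 R) rfl := by simp [s, p']
  obtain ⟨l, hl⟩ := exists_factor_of_split (prod.lift r₁ r₂) p s hs
    (prod.lift (p' ≫ pullback.snd r₂ r₂ ≫ r₁) (p ≫ pullback.fst r₁ r₁ ≫ r₂))
    ⟨pullback.fst r₁ r₁, by
      ext
      · simp [reassoc_of% hs', pullback.condition]
      · simp [reassoc_of% hs]⟩
    ⟨kernel.ι p ≫ p' ≫ pullback.snd r₂ r₂, by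
      ext
      · simp
      · simp [← pullback.condition, ← reassoc_of% hp]⟩
  let t : T ⟶ pullback (pullback.snd r₁ r₁) (pullback.fst r₂ r₂) :=
    pullback.lift (pullback.lift a b hab) (pullback.lift b c hbc) (by simp)
  refine ⟨t ≫ l, ?_, ?_⟩
  · have := t ≫= hl =≫ prod.fst
    simpa [t, p, p'] using this
  · have := t ≫= hl =≫ prod.snd
    simpa [t, p, p'] using this

/-- In a semi-abelian category reflexive relations are equivalence relations. -/
theorem isEquivalenceRelation_of_reflexive {R X : C} (r₁ r₂ : R ⟶ X) [JointlyMono₂ r₁ r₂]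
    (ρ : X ⟶ R) (h₁ : ρ ≫ r₁ = 𝟙 X) (h₂ : ρ ≫ r₂ = 𝟙 X) : IsEquivalenceRelation r₁ r₂ := by
  obtain ⟨s, hs₁, hs₂⟩ := maltsev r₁ r₂ (r₁ ≫ ρ) (𝟙 R) (r₂ ≫ ρ) (by simp [h₁]) (by simp [h₂])
  obtain ⟨t, ht₁, ht₂⟩ := maltsev r₁ r₂ (pullback.snd r₂ r₁) (pullback.fst r₂ r₁ ≫ r₂ ≫ ρ)
    (pullback.fst r₂ r₁) (by simp [h₁, pullback.condition]) (by simp [h₂])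
  exact ⟨⟨{
    right_cancellation := JointlyMono₂.right_cancellation
    r := ρ
    reflexivity₁ := h₁
    reflexivity₂ := h₂
    s := s
    symmetry₁ := by simpa [h₁] using hs₁
    symmetry₂ := by simpa [h₂] using hs₂
    c := PullbackCone.mk _ _ pullback.condition
    isLimit := pullbackIsPullback r₂ r₁
    t := t
    transitivity₁ := ht₁
    transitivity₂ := ht₂ }⟩⟩

/-! ### Exact forks -/

/-- A fork `A ⇉ E ⟶ Q` is exact if `q` is a regular epimorphism and `A` covers its kernel pair.
Such a fork is a coequalizer, and unlike a general coequalizer it is stable under pullback. -/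
structure IsExactFork {A E Q : C} (f g : A ⟶ E) (q : E ⟶ Q) : Prop where
  isRegularEpi : IsRegularEpi q
  exists_cover : ∃ (R : C) (p₁ p₂ : R ⟶ E) (c : A ⟶ R),
    IsKernelPair q p₁ p₂ ∧ IsRegularEpi c ∧ c ≫ p₁ = f ∧ c ≫ p₂ = g

theorem isRegularEpi_comp {X Y Z : C} (f : X ⟶ Y) (g : Y ⟶ Z) [IsRegularEpi f] [IsRegularEpi g] :
    IsRegularEpi (f ≫ g) := by
  have : StrongEpi (f ≫ g) := strongEpi_comp f g
  infer_instance

theorem isRegularEpi_of_comp {X Y Z : C} (f : X ⟶ Y) (g : Y ⟶ Z) [IsRegularEpi (f ≫ g)] :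
    IsRegularEpi g := by
  have : StrongEpi g := strongEpi_of_strongEpi f g
  infer_instance

theorem isRegularEpi_of_isPullback {P X Y Z : C} {f : P ⟶ X} {g : P ⟶ Y} {h : X ⟶ Z}
    {k : Y ⟶ Z} (sq : IsPullback f g h k) (hh : IsRegularEpi h) : IsRegularEpi g :=
  Regular.regularEpiIsStableUnderBaseChange.of_isPullback sq hh

namespace IsExactFork

variable {A E Q : C} {f g : A ⟶ E} {q : E ⟶ Q}

theorem w (h : IsExactFork f g q) : f ≫ q = g ≫ q := by
  obtain ⟨R, p₁, p₂, c, hR, -, rfl, rfl⟩ := h.exists_cover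
  simp [hR.w]

theorem exists_desc (h : IsExactFork f g q) {Z : C} (k : E ⟶ Z) (hk : f ≫ k = g ≫ k) :
    ∃ l, q ≫ l = k := by
  obtain ⟨R, p₁, p₂, c, hR, hc, rfl, rfl⟩ := h.exists_cover
  have := h.isRegularEpi
  refine IsRegularEpi.exists_of_isKernelPair q hR k ?_
  rw [← cancel_epi c]
  simpa using hk

theorem comp_isIso (h : IsExactFork f g q) {Q' : C} (i : Q ⟶ Q') [IsIso i] :
    IsExactFork f g (q ≫ i) := by
  obtain ⟨R, p₁, p₂, c, hR, hc⟩ := h.exists_cover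
  have := h.isRegularEpi
  exact ⟨isRegularEpi_comp q i, R, p₁, p₂, c, hR.comp_of_mono, hc⟩

/-- Any coequalizer of a pair which has an exact fork is exact. -/
theorem of_coequalizer (h : IsExactFork f g q) {Q' : C} (q' : E ⟶ Q') [Epi q']
    (w' : f ≫ q' = g ≫ q') (desc : ∀ {Z : C} (k : E ⟶ Z), f ≫ k = g ≫ k → ∃ l, q' ≫ l = k) :
    IsExactFork f g q' := by
  have := h.isRegularEpi
  obtain ⟨i, hi⟩ := h.exists_desc q' w'
  obtain ⟨j, hj⟩ := desc q h.w
  have : IsIso i := ⟨j, by rw [← cancel_epi q, reassoc_of% hi, hj, Category.comp_id],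
    by rw [← cancel_epi q', reassoc_of% hj, hi, Category.comp_id]⟩
  exact hi ▸ h.comp_isIso i

/-- The pullback of an exact fork along a monomorphism `n` is exact. -/
theorem of_isPullback (h : IsExactFork f g q) {A' E' N : C} {f' g' : A' ⟶ E'} {q' : E' ⟶ N}
    {n : N ⟶ Q} [Mono n] {e : E' ⟶ E} {a : A' ⟶ A} (hE : IsPullback e q' q n)
    (hf : IsPullback a f' f e) (hg : a ≫ g = g' ≫ e) : IsExactFork f' g' q' := by
  obtain ⟨R, p₁, p₂, c, hR, hc, rfl, rfl⟩ := h.exists_cover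
  have hw : f' ≫ q' = g' ≫ q' := by
    rw [← cancel_mono n, Category.assoc, Category.assoc, ← hE.w, ← reassoc_of% hf.w,
      ← reassoc_of% hg, hR.w]
  refine ⟨isRegularEpi_of_isPullback hE h.isRegularEpi, pullback q' q', _, _,
    pullback.lift f' g' hw, IsKernelPair.of_hasPullback q', ?_, by simp, by simp⟩
  have hw' : (pullback.fst q' q' ≫ e) ≫ q = (pullback.snd q' q' ≫ e) ≫ q := by
    simp only [Category.assoc, hE.w, pullback.condition_assoc]
  refine isRegularEpi_of_isPullback (f := a) (h := c)
    (k := hR.lift (pullback.fst q' q' ≫ e) (pullback.snd q' q' ≫ e) hw') ?_ hc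
  refine ⟨⟨hR.hom_ext (by simpa using hf.w) (by simpa using hg)⟩,
    ⟨PullbackCone.IsLimit.mk _ (fun t ↦ hf.lift t.fst (t.snd ≫ pullback.fst q' q') ?_)
      (fun t ↦ hf.lift_fst _ _ _) (fun t ↦ ?_) (fun t m h₁ h₂ ↦ ?_)⟩⟩
  · simpa using t.condition =≫ p₁
  · have h₁ : t.fst ≫ c ≫ p₂ = (t.snd ≫ pullback.snd q' q') ≫ e := by
      simpa using t.condition =≫ p₂
    apply pullback.hom_ext
    · simp
    · apply hE.hom_ext
      · simp only [Category.assoc, pullback.lift_snd, ← hg, hf.lift_fst_assoc]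
        simpa using h₁
      · simp only [Category.assoc, pullback.lift_snd, ← hw, hf.lift_snd_assoc, pullback.condition]
  · apply hf.hom_ext
    · simpa using h₁
    · rw [hf.lift_snd, ← h₂, Category.assoc, pullback.lift_fst]

end IsExactFork

/-- A pair `f, g` which is reflexive up to a cover `e` of `E` has an exact quotient: the image of
`(f, g)` in `E ⨯ E` is a reflexive relation, hence an equivalence relation, hence effective. -/
theorem exists_isExactFork {A E D : C} (f g : A ⟶ E) (e : D ⟶ E) [IsRegularEpi e] (r : D ⟶ A)
    (hf : r ≫ f = e) (hg : r ≫ g = e) : ∃ (Q : C) (q : E ⟶ Q), IsExactFork f g q := by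
  let F := Regular.strongEpiMonoFactorisation (prod.lift f g)
  have : JointlyMono₂ (F.m ≫ prod.fst) (F.m ≫ prod.snd) := ⟨fun T x y h₁ h₂ ↦ by
    rw [← cancel_mono F.m]
    ext
    · simpa using h₁
    · simpa using h₂⟩
  -- The image contains the diagonal because `e` is orthogonal to its inclusion.
  have sq : CommSq (r ≫ F.e) e F.m (prod.lift (𝟙 E) (𝟙 E)) := ⟨by
    rw [Category.assoc, F.fac]
    ext <;> simp [hf, hg]⟩
  have hρ : sq.lift ≫ F.m = prod.lift (𝟙 E) (𝟙 E) := sq.fac_right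
  have hR := isEquivalenceRelation_of_reflexive (F.m ≫ prod.fst) (F.m ≫ prod.snd) sq.lift
    (by simp [reassoc_of% hρ]) (by simp [reassoc_of% hρ])
  obtain ⟨Q, q, hq⟩ := SemiAbelian.exact _ _ hR
  let G := Regular.strongEpiMonoFactorisation q
  refine ⟨G.I, G.e, inferInstanceAs (IsRegularEpi (Regular.strongEpiMonoFactorisation q).e),
    F.I, F.m ≫ prod.fst, F.m ≫ prod.snd, F.e, ?_,
    inferInstanceAs (IsRegularEpi (Regular.strongEpiMonoFactorisation (prod.lift f g)).e),
    by simp, by simp⟩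
  rw [← G.fac] at hq
  exact hq.cancel_right_of_mono

/-- A pushout of regular epimorphisms `φ : E ⟶ S`, `ψ : E ⟶ T` presents the quotient of `S` by the
direct image of the kernel pair of `ψ`. -/
theorem isExactFork_of_isPushout {E S T P : C} {φ : E ⟶ S} {ψ : E ⟶ T} {l : S ⟶ P} {r : T ⟶ P}
    [IsRegularEpi φ] [IsRegularEpi ψ] (h : IsPushout φ ψ l r) :
    IsExactFork (pullback.fst ψ ψ ≫ φ) (pullback.snd ψ ψ ≫ φ) l := by
  obtain ⟨Q, q, hq⟩ := exists_isExactFork (pullback.fst ψ ψ ≫ φ) (pullback.snd ψ ψ ≫ φ) φ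
    (pullback.lift (𝟙 E) (𝟙 E) rfl) (by simp) (by simp)
  have desc : ∀ {Z : C} (k : S ⟶ Z),
      (pullback.fst ψ ψ ≫ φ) ≫ k = (pullback.snd ψ ψ ≫ φ) ≫ k → ∃ k', l ≫ k' = k := by
    intro Z k hk
    obtain ⟨k', hk'⟩ := IsRegularEpi.exists_of_isKernelPair ψ (IsKernelPair.of_hasPullback ψ)
      (φ ≫ k) (by simpa using hk)
    exact ⟨h.desc k k' hk'.symm, h.inl_desc _ _ _⟩
  have : Epi l := ⟨fun a b hab ↦ h.hom_ext hab (by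
    rw [← cancel_epi ψ, ← reassoc_of% h.w, ← reassoc_of% h.w, hab])⟩
  exact hq.of_coequalizer l (by simp only [Category.assoc, h.w, pullback.condition_assoc]) desc

/-- The kernel of the diagonal of a pushout of regular epimorphisms is contained in any subobject
containing the kernels of both. -/
theorem exists_factor_kernel_of_isPushout {E S T P J : C} {φ : E ⟶ S} {ψ : E ⟶ T} {l : S ⟶ P}
    {r : T ⟶ P} [IsRegularEpi φ] [IsRegularEpi ψ] (h : IsPushout φ ψ l r) (m : J ⟶ E) [Mono m]
    (hφ : ∃ a, a ≫ m = kernel.ι φ) (hψ : ∃ a, a ≫ m = kernel.ι ψ) :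
    ∃ a, a ≫ m = kernel.ι (φ ≫ l) := by
  obtain ⟨R, p₁, p₂, c, hR, hc, hc₁, hc₂⟩ := (isExactFork_of_isPushout h).exists_cover
  -- An element `z` of the kernel is locally related to `0` by a chain `0 ~ a ~ b ~ z`, where
  -- `φ a = 0`, `ψ a = ψ b` and `φ b = φ z`.
  let y := hR.lift 0 (kernel.ι (φ ≫ l) ≫ φ) (by simp)
  let α := pullback.fst c y
  let e := pullback.snd c y
  have hα : α ≫ c = e ≫ y := pullback.condition
  have ha : (α ≫ pullback.fst ψ ψ) ≫ φ = 0 := by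
    rw [Category.assoc, ← hc₁, reassoc_of% hα, hR.lift_fst, comp_zero]
  have hb : (α ≫ pullback.snd ψ ψ) ≫ φ = (e ≫ kernel.ι (φ ≫ l)) ≫ φ := by
    rw [Category.assoc, ← hc₂, reassoc_of% hα, hR.lift_snd, Category.assoc]
  obtain ⟨k, hk⟩ := hφ
  obtain ⟨u, hu⟩ := exists_factor_of_kernel m φ ⟨k, hk⟩ _ _ hb
    (exists_factor_of_kernel m ψ hψ (α ≫ pullback.fst ψ ψ) _
      (by simp only [Category.assoc, pullback.condition])
      ⟨kernel.lift φ _ ha ≫ k, by rw [Category.assoc, hk, kernel.lift_ι]⟩)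
  have sq : CommSq u e m (kernel.ι (φ ≫ l)) := ⟨hu⟩
  exact ⟨sq.lift, sq.fac_right⟩

/-! ### Kernels of split epimorphisms and the functors `B ♭ -` -/

/-- `k` is a kernel of `p`, stated elementwise. -/
structure IsKer {K E B : C} (k : K ⟶ E) (p : E ⟶ B) : Prop where
  mono : Mono k
  w : k ≫ p = 0
  exists_lift : ∀ {T : C} (t : T ⟶ E), t ≫ p = 0 → ∃ l, l ≫ k = t

theorem isKer_kernel {E B : C} (p : E ⟶ B) : IsKer (kernel.ι p) p :=
  ⟨inferInstance, kernel.condition p, fun t ht ↦ ⟨kernel.lift p t ht, by simp⟩⟩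

theorem isKer_flatι (B X : C) : IsKer (flatι B X) (coprod.desc (𝟙 B) (0 : X ⟶ B)) :=
  isKer_kernel _

instance (B X : C) : Mono (flatι B X) := (isKer_flatι B X).mono

theorem IsKer.isPullback {A E B K K' : C} {f : A ⟶ E} {p : E ⟶ B} {p' : A ⟶ B} {k : K ⟶ A}
    {k' : K' ⟶ E} {f' : K ⟶ K'} (hk : IsKer k p') (hk' : IsKer k' p) (hp : f ≫ p = p')
    (w : k ≫ f = f' ≫ k') : IsPullback k f' f k' := by
  subst hp
  have := hk.mono
  have := hk'.mono
  have h : ∀ t : PullbackCone f k', t.fst ≫ f ≫ p = 0 := fun t ↦ by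
    rw [reassoc_of% t.condition, hk'.w, comp_zero]
  choose l hl using fun t : PullbackCone f k' ↦ hk.exists_lift t.fst (h t)
  refine ⟨⟨w⟩, ⟨PullbackCone.IsLimit.mk _ l hl (fun t ↦ ?_) (fun t m h₁ _ ↦ ?_)⟩⟩
  · rw [← cancel_mono k', Category.assoc, ← w, reassoc_of% hl, t.condition]
  · rw [← cancel_mono k, hl, h₁]

theorem IsKer.of_iso {K K' E B : C} {k : K ⟶ E} {p : E ⟶ B} (hk : IsKer k p) (i : K' ⟶ K)
    [IsIso i] : IsKer (i ≫ k) p :=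
  have := hk.mono
  ⟨inferInstance, by rw [Category.assoc, hk.w, comp_zero], fun t ht ↦ by
    obtain ⟨l, hl⟩ := hk.exists_lift t ht
    exact ⟨l ≫ inv i, by simpa using hl⟩⟩

theorem map_desc_zero {B B' X X' : C} (f : B ⟶ B') (g : X ⟶ X') :
    coprod.map f g ≫ coprod.desc (𝟙 B') (0 : X' ⟶ B') =
      coprod.desc (𝟙 B) (0 : X ⟶ B) ≫ f := by
  ext <;> simp

theorem isPullback_flatMap (B : C) {X X' : C} (f : X ⟶ X') :
    IsPullback (flatι B X) (flatMap (𝟙 B) f) (coprod.map (𝟙 B) f) (flatι B X') :=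
  (isKer_flatι B X).isPullback (isKer_flatι B X')
    (by rw [map_desc_zero, Category.comp_id]) (flatMap_ι _ _).symm

instance isRegularEpi_map (B : C) {X X' : C} (f : X ⟶ X') [IsRegularEpi f] :
    IsRegularEpi (coprod.map (𝟙 B) f) := by
  have : StrongEpi (coprod.map (𝟙 B) f) := StrongEpi.mk' fun M N m _ u v sq ↦ by
    have sq' : CommSq (coprod.inr ≫ u) f m (coprod.inr ≫ v) := ⟨by simp [sq.w]⟩
    have h : coprod.inl ≫ u ≫ m = coprod.inl ≫ v := by simp [sq.w]
    refine ⟨⟨⟨coprod.desc (coprod.inl ≫ u) sq'.lift, ?_, ?_⟩⟩⟩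
    · ext <;> simp
    · ext <;> simp [h]
  infer_instance

instance isRegularEpi_flatMap (B : C) {X X' : C} (f : X ⟶ X') [IsRegularEpi f] :
    IsRegularEpi (flatMap (𝟙 B) f) :=
  isRegularEpi_of_isPullback (isPullback_flatMap B f) inferInstance

/-- `B + -` preserves the exact quotient of a pair which is reflexive up to a cover. -/
theorem IsExactFork.coprodMap {A E D Q : C} {f g : A ⟶ E} {q : E ⟶ Q} (h : IsExactFork f g q)
    (e : D ⟶ E) [IsRegularEpi e] (r : D ⟶ A) (hf : r ≫ f = e) (hg : r ≫ g = e) (B : C) :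
    IsExactFork (coprod.map (𝟙 B) f) (coprod.map (𝟙 B) g) (coprod.map (𝟙 B) q) := by
  obtain ⟨Q', q', hq'⟩ := exists_isExactFork (coprod.map (𝟙 B) f) (coprod.map (𝟙 B) g)
    (coprod.map (𝟙 B) e) (coprod.map (𝟙 B) r) (by simp [hf]) (by simp [hg])
  have := h.isRegularEpi
  refine hq'.of_coequalizer _ (by simp [h.w]) fun k hk ↦ ?_
  obtain ⟨l, hl⟩ := h.exists_desc (coprod.inr ≫ k) (by simpa using coprod.inr ≫= hk)
  exact ⟨coprod.desc (coprod.inl ≫ k) l, by ext <;> simp [hl]⟩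

/-- `B ♭ -` preserves the exact quotient of a pair which is reflexive up to a cover. -/
theorem IsExactFork.flatMap {A E D Q : C} {f g : A ⟶ E} {q : E ⟶ Q} (h : IsExactFork f g q)
    (e : D ⟶ E) [IsRegularEpi e] (r : D ⟶ A) (hf : r ≫ f = e) (hg : r ≫ g = e) (B : C) :
    IsExactFork (flatMap (𝟙 B) f) (flatMap (𝟙 B) g) (flatMap (𝟙 B) q) :=
  (h.coprodMap e r hf hg B).of_isPullback (isPullback_flatMap B q) (isPullback_flatMap B f)
    (isPullback_flatMap B g).w

@[simp]
theorem flatUnit_ι (B X : C) : flatUnit B X ≫ flatι B X = coprod.inr := flatLift_ι _ _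

@[simp]
theorem flatUnit_ι_assoc (B X : C) {Z : C} (h : B ⨿ X ⟶ Z) :
    flatUnit B X ≫ flatι B X ≫ h = coprod.inr ≫ h := by
  rw [← Category.assoc, flatUnit_ι]

theorem flatMul_ι (B X : C) :
    flatMul B X ≫ flatι B X = flatι B (flat B X) ≫ coprod.desc coprod.inl (flatι B X) :=
  flatLift_ι _ _

theorem flatUnit_flatMap {B B' X X' : C} (f : B ⟶ B') (g : X ⟶ X') :
    flatUnit B X ≫ flatMap f g = g ≫ flatUnit B' X' := by
  apply flat_hom_ext
  rw [Category.assoc, flatMap_ι, ← Category.assoc, flatUnit_ι, Category.assoc, flatUnit_ι]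
  simp

theorem flatMul_flatMap {B B' X X' : C} (f : B ⟶ B') (g : X ⟶ X') :
    flatMul B X ≫ flatMap f g = flatMap f (flatMap f g) ≫ flatMul B' X' := by
  apply flat_hom_ext
  rw [Category.assoc, flatMap_ι, ← Category.assoc, flatMul_ι, Category.assoc, Category.assoc,
    flatMul_ι, ← Category.assoc (flatMap f _), flatMap_ι, Category.assoc]
  congr 1
  ext <;> simp

theorem flatUnit_flatMul (B X : C) : flatUnit B (flat B X) ≫ flatMul B X = 𝟙 _ := by
  apply flat_hom_ext
  rw [Category.assoc, flatMul_ι, ← Category.assoc, flatUnit_ι]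
  simp

theorem flatMap_flatUnit_flatMul (B X : C) :
    flatMap (𝟙 B) (flatUnit B X) ≫ flatMul B X = 𝟙 _ := by
  apply flat_hom_ext
  rw [Category.assoc, flatMul_ι, ← Category.assoc, flatMap_ι, Category.assoc]
  have : coprod.map (𝟙 B) (flatUnit B X) ≫ coprod.desc coprod.inl (flatι B X) = 𝟙 _ := by
    ext <;> simp
  rw [this, Category.comp_id, Category.id_comp]

theorem flatMul_flatMul (B X : C) :
    flatMul B (flat B X) ≫ flatMul B X = flatMap (𝟙 B) (flatMul B X) ≫ flatMul B X := by
  apply flat_hom_ext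
  rw [Category.assoc, flatMul_ι, ← Category.assoc, flatMul_ι, Category.assoc, Category.assoc,
    flatMul_ι, ← Category.assoc (flatMap _ _), flatMap_ι, Category.assoc]
  congr 1
  ext <;> simp [flatMul_ι]

theorem flatMap_zero (B X Y : C) : flatMap (𝟙 B) (0 : X ⟶ Y) = 0 := by
  have h : coprod.map (𝟙 B) (0 : X ⟶ Y) = coprod.desc (𝟙 B) (0 : X ⟶ B) ≫ coprod.inl := by
    ext <;> simp
  apply flat_hom_ext
  rw [flatMap_ι, h, ← Category.assoc, flatι_desc, zero_comp, zero_comp]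

theorem flatMap_conj {B B' X : C} (f : B ⟶ B') (g : X ⟶ B') :
    flatMap f g ≫ conj B' = flatι B X ≫ coprod.desc f g := by
  rw [conj, ← Category.assoc, flatMap_ι, Category.assoc]
  congr 1
  ext <;> simp

theorem conj_comp {B B' : C} (f : B ⟶ B') : conj B ≫ f = flatMap f f ≫ conj B' := by
  rw [flatMap_conj, conj, Category.assoc]
  congr 1
  ext <;> simp

/-! ### Actions -/

/-- `ξ` is an action of `B` on `X`, that is, an algebra structure for the monad `B ♭ -`. -/
structure IsAction {B X : C} (ξ : flat B X ⟶ X) : Prop where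
  unit : flatUnit B X ≫ ξ = 𝟙 X
  mul : flatMul B X ≫ ξ = flatMap (𝟙 B) ξ ≫ ξ

theorem isAction_conj (B : C) : IsAction (conj B) where
  unit := by simp [conj]
  mul := by
    rw [flatMap_conj, conj, ← Category.assoc, flatMul_ι, Category.assoc]
    congr 1
    ext <;> simp

theorem PXMod.isAction {B : C} (X : PXMod B) : IsAction X.act := ⟨X.act_unit, X.act_mul⟩

theorem IsAction.restrict {B B' X : C} {ξ : flat B X ⟶ X} (h : IsAction ξ) (f : B' ⟶ B) :
    IsAction (flatMap f (𝟙 X) ≫ ξ) where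
  unit := by rw [← Category.assoc, flatUnit_flatMap, Category.id_comp, h.unit]
  mul := by
    rw [← Category.assoc, flatMul_flatMap, Category.assoc, h.mul, ← Category.assoc,
      ← Category.assoc, flatMap_comp, flatMap_comp]
    simp

theorem isAction_inducedAct {B : C} (X Y : PXMod B) : IsAction (inducedAct X Y) :=
  X.isAction.restrict Y.δ

/-- An action on `X` is detected on a jointly monic pair of equivariant morphisms. -/
theorem isAction_of_jointlyMono {B X Y Z : C} {ξ : flat B X ⟶ X} {υ : flat B Y ⟶ Y}
    {ζ : flat B Z ⟶ Z} (hυ : IsAction υ) (hζ : IsAction ζ) (f : X ⟶ Y) (g : X ⟶ Z)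
    (hfg : ∀ {T : C} (a b : T ⟶ X), a ≫ f = b ≫ f → a ≫ g = b ≫ g → a = b)
    (hf : ξ ≫ f = flatMap (𝟙 B) f ≫ υ) (hg : ξ ≫ g = flatMap (𝟙 B) g ≫ ζ) : IsAction ξ := by
  have unit : ∀ {Y : C} {υ : flat B Y ⟶ Y} (_ : IsAction υ) (f : X ⟶ Y)
      (_ : ξ ≫ f = flatMap (𝟙 B) f ≫ υ), (flatUnit B X ≫ ξ) ≫ f = 𝟙 X ≫ f := by
    intro Y υ hυ f hf
    rw [Category.assoc, hf, ← Category.assoc, flatUnit_flatMap, Category.assoc, hυ.unit]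
    simp
  have mul : ∀ {Y : C} {υ : flat B Y ⟶ Y} (_ : IsAction υ) (f : X ⟶ Y)
      (_ : ξ ≫ f = flatMap (𝟙 B) f ≫ υ),
      (flatMul B X ≫ ξ) ≫ f = (flatMap (𝟙 B) ξ ≫ ξ) ≫ f := by
    intro Y υ hυ f hf
    rw [Category.assoc, hf, ← Category.assoc, flatMul_flatMap, Category.assoc, hυ.mul,
      Category.assoc, hf, ← Category.assoc, ← Category.assoc, flatMap_comp, flatMap_comp, hf]
  exact ⟨hfg _ _ (unit hυ f hf) (unit hζ g hg), hfg _ _ (mul hυ f hf) (mul hζ g hg)⟩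

/-! ### Quotients of pre-crossed modules -/

namespace PXMod

@[simp]
theorem comp_hom {B : C} {X Y Z : PXMod B} (f : X ⟶ Y) (g : Y ⟶ Z) :
    Hom.hom (f ≫ g) = Hom.hom f ≫ Hom.hom g := rfl

theorem hom_ext {B : C} {X Y : PXMod B} {f g : X ⟶ Y} (h : Hom.hom f = Hom.hom g) : f = g :=
  Hom.ext h

/-- The functor sending a pre-crossed module to its underlying object. -/
@[simps]
def forget (B : C) : PXMod B ⥤ C where
  obj X := X.obj
  map f := Hom.hom f

/-- A morphism through which a morphism of pre-crossed modules factors after a regular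
epimorphism of pre-crossed modules is one of pre-crossed modules. -/
theorem exists_hom_of_isRegularEpi {B : C} {M P N : PXMod B} (π : M ⟶ P)
    [IsRegularEpi (Hom.hom π)] (h : M ⟶ N) (k : P.obj ⟶ N.obj) (hk : Hom.hom π ≫ k = Hom.hom h) :
    ∃ k' : P ⟶ N, Hom.hom k' = k ∧ π ≫ k' = h := by
  refine ⟨⟨k, ?_, ?_⟩, rfl, hom_ext hk⟩
  · rw [← cancel_epi (Hom.hom π), ← Category.assoc, hk, Hom.comp_δ, Hom.comp_δ]
  · rw [← cancel_epi (flatMap (𝟙 B) (Hom.hom π)), ← Category.assoc, ← Hom.act_comp,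
      Category.assoc, hk, Hom.act_comp, ← Category.assoc, flatMap_comp, hk, Category.comp_id]

/-- The exact quotient, in `C`, of a pre-crossed module by a pair of morphisms which is reflexive
up to a cover and compatible with the action and with the structure morphism is again a
pre-crossed module, because `B ♭ -` preserves this quotient. -/
theorem exists_quotient {B A D Q : C} (M : PXMod B) {f g : A ⟶ M.obj} {q : M.obj ⟶ Q}
    (h : IsExactFork f g q) (e : D ⟶ M.obj) [IsRegularEpi e] (r : D ⟶ A) (hf : r ≫ f = e)
    (hg : r ≫ g = e)
    (hact : flatMap (𝟙 B) f ≫ M.act ≫ q = flatMap (𝟙 B) g ≫ M.act ≫ q)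
    (hδ : f ≫ M.δ = g ≫ M.δ) :
    ∃ (P : PXMod B) (π : M ⟶ P), IsExactFork f g (Hom.hom π) := by
  have := h.isRegularEpi
  obtain ⟨act, hact⟩ := (h.flatMap e r hf hg B).exists_desc (M.act ≫ q) hact
  obtain ⟨δ, hδ⟩ := h.exists_desc M.δ hδ
  refine ⟨⟨Q, δ, act, ?_, ?_, ?_⟩, ⟨q, hδ, hact.symm⟩, h⟩
  · rw [← cancel_epi q, ← Category.assoc, ← flatUnit_flatMap (𝟙 B), Category.assoc, hact,
      ← Category.assoc, M.act_unit]
    simp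
  · rw [← cancel_epi (Peiffer.flatMap (𝟙 B) (Peiffer.flatMap (𝟙 B) q)), ← Category.assoc,
      ← flatMul_flatMap, Category.assoc, hact, ← Category.assoc, M.act_mul, Category.assoc,
      ← hact, ← Category.assoc, ← Category.assoc, flatMap_comp, flatMap_comp, hact]
  · rw [← cancel_epi (Peiffer.flatMap (𝟙 B) q), ← Category.assoc, hact, Category.assoc, hδ,
      M.precrossed, ← Category.assoc, flatMap_comp, hδ, Category.comp_id]

end PXMod

/-! ### Coproducts of pre-crossed modules -/

namespace PXMod

/-- The free pre-crossed module on a morphism `z : Z ⟶ B`, with underlying object `B ♭ Z`. -/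
@[simps]
noncomputable def free {B Z : C} (z : Z ⟶ B) : PXMod B where
  obj := flat B Z
  δ := flatMap (𝟙 B) z ≫ conj B
  act := flatMul B Z
  act_unit := flatUnit_flatMul B Z
  act_mul := flatMul_flatMul B Z
  precrossed := by
    rw [← Category.assoc, flatMul_flatMap, Category.assoc, (isAction_conj B).mul,
      ← Category.assoc, flatMap_comp, Category.comp_id]

/-- Equivariant morphisms out of a free action `B ♭ Z` are determined by their restriction to
`Z`. -/
theorem eq_flatMap_act {B Z : C} {N : PXMod B} (u : flat B Z ⟶ N.obj)
    (h : flatMul B Z ≫ u = flatMap (𝟙 B) u ≫ N.act) :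
    u = flatMap (𝟙 B) (flatUnit B Z ≫ u) ≫ N.act := by
  have h' : flatMap (𝟙 B) (flatUnit B Z ≫ u) =
      flatMap (𝟙 B) (flatUnit B Z) ≫ flatMap (𝟙 B) u := by
    rw [flatMap_comp, Category.comp_id]
  rw [h', Category.assoc, ← h, ← Category.assoc, flatMap_flatUnit_flatMul, Category.id_comp]

theorem flatMul_flatMap_act {B Z : C} {N : PXMod B} (h : Z ⟶ N.obj) :
    flatMul B Z ≫ flatMap (𝟙 B) h ≫ N.act =
      flatMap (𝟙 B) (flatMap (𝟙 B) h ≫ N.act) ≫ N.act := by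
  rw [← Category.assoc, flatMul_flatMap, Category.assoc, N.act_mul, ← Category.assoc,
    flatMap_comp, Category.comp_id]

/-- The canonical morphism `(B ♭ X) + (B ♭ Y) ⟶ B ♭ (X + Y)`. -/
noncomputable def flatCoprod (B X Y : C) : flat B X ⨿ flat B Y ⟶ flat B (X ⨿ Y) :=
  coprod.desc (flatMap (𝟙 B) coprod.inl) (flatMap (𝟙 B) coprod.inr)

theorem map_act_desc {B : C} {X Y N : PXMod B} (h : X ⟶ N) (k : Y ⟶ N) :
    coprod.map X.act Y.act ≫ coprod.desc (Hom.hom h) (Hom.hom k) =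
      flatCoprod B X.obj Y.obj ≫
        flatMap (𝟙 B) (coprod.desc (Hom.hom h) (Hom.hom k)) ≫ N.act := by
  ext
  · simp only [flatCoprod, coprod.inl_map_assoc, coprod.inl_desc, coprod.inl_desc_assoc,
      Hom.act_comp]
    rw [← Category.assoc (flatMap _ _), flatMap_comp, coprod.inl_desc, Category.comp_id]
  · simp only [flatCoprod, coprod.inr_map_assoc, coprod.inr_desc, coprod.inr_desc_assoc,
      Hom.act_comp]
    rw [← Category.assoc (flatMap _ _), flatMap_comp, coprod.inr_desc, Category.comp_id]

/-- `B` as a pre-crossed module over itself, with the conjugation action; it is terminal. -/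
noncomputable def base (B : C) : PXMod B where
  obj := B
  δ := 𝟙 B
  act := conj B
  act_unit := (isAction_conj B).unit
  act_mul := (isAction_conj B).mul
  precrossed := by simp [flatMap_id]

/-- The structure morphism of a pre-crossed module, as a morphism to the terminal one. -/
def toBase {B : C} (X : PXMod B) : X ⟶ base B :=
  ⟨X.δ, Category.comp_id _, X.precrossed⟩

/-- For a pre-crossed module `N`, the morphism `B ♭ (X + Y) ⟶ N` induced by equivariant
morphisms from `X` and `Y` coequalizes the pair presenting the coproduct. -/
theorem coproduct_relations {B : C} {X Y N : PXMod B} (h : X ⟶ N) (k : Y ⟶ N) :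
    flatMap (𝟙 B) (coprod.map X.act Y.act) ≫
        flatMap (𝟙 B) (coprod.desc (Hom.hom h) (Hom.hom k)) ≫ N.act =
      (flatMap (𝟙 B) (flatCoprod B X.obj Y.obj) ≫ flatMul B (X.obj ⨿ Y.obj)) ≫
        flatMap (𝟙 B) (coprod.desc (Hom.hom h) (Hom.hom k)) ≫ N.act := by
  rw [← Category.assoc, flatMap_comp, map_act_desc, Category.assoc, flatMul_flatMap_act,
    ← Category.assoc (flatMap _ (flatCoprod _ _ _)), flatMap_comp]

/-- The presentation of the coproduct of `X` and `Y` as a quotient `π` of the free pre-crossed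
module on `[δ_X, δ_Y] : X + Y ⟶ B`. -/
theorem exists_coproduct_presentation {B : C} (X Y : PXMod B) :
    ∃ (P : PXMod B) (π : flat B (X.obj ⨿ Y.obj) ⟶ P.obj),
      IsExactFork (flatMap (𝟙 B) (coprod.map X.act Y.act))
        (flatMap (𝟙 B) (flatCoprod B X.obj Y.obj) ≫ flatMul B (X.obj ⨿ Y.obj)) π ∧
      π ≫ P.δ = flatMap (𝟙 B) (coprod.desc X.δ Y.δ) ≫ conj B ∧
      flatMul B (X.obj ⨿ Y.obj) ≫ π = flatMap (𝟙 B) π ≫ P.act := by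
  have hf : flatMap (𝟙 B) (coprod.map (flatUnit B X.obj) (flatUnit B Y.obj)) ≫
      flatMap (𝟙 B) (coprod.map X.act Y.act) = 𝟙 _ := by
    rw [flatMap_comp, coprod.map_map, X.act_unit, Y.act_unit]
    simp [flatMap_id]
  have hg : flatMap (𝟙 B) (coprod.map (flatUnit B X.obj) (flatUnit B Y.obj)) ≫
      flatMap (𝟙 B) (flatCoprod B X.obj Y.obj) ≫ flatMul B (X.obj ⨿ Y.obj) = 𝟙 _ := by
    have : coprod.map (flatUnit B X.obj) (flatUnit B Y.obj) ≫ flatCoprod B X.obj Y.obj =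
        flatUnit B _ := by
      ext <;> simp [flatCoprod, flatUnit_flatMap]
    rw [← Category.assoc, flatMap_comp, this, Category.comp_id, flatMap_flatUnit_flatMul]
  have hμ : ∀ (a : flat B X.obj ⨿ flat B Y.obj ⟶ flat B (X.obj ⨿ Y.obj)),
      flatMap (𝟙 B) (flatMap (𝟙 B) a ≫ flatMul B (X.obj ⨿ Y.obj)) ≫ flatMul B (X.obj ⨿ Y.obj) =
        flatMul B _ ≫ flatMap (𝟙 B) a ≫ flatMul B (X.obj ⨿ Y.obj) := by
    intro a
    rw [← Category.assoc (flatMul B _), flatMul_flatMap, Category.assoc, flatMul_flatMul,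
      ← Category.assoc, flatMap_comp, Category.comp_id]
  obtain ⟨Q, q, hq⟩ := exists_isExactFork _ _ (𝟙 _) _ hf hg
  have hact : flatMap (𝟙 B) (flatMap (𝟙 B) (coprod.map X.act Y.act)) ≫
      flatMul B (X.obj ⨿ Y.obj) ≫ q =
        flatMap (𝟙 B) (flatMap (𝟙 B) (flatCoprod B X.obj Y.obj) ≫ flatMul B (X.obj ⨿ Y.obj)) ≫
          flatMul B (X.obj ⨿ Y.obj) ≫ q := by
    rw [← Category.assoc, ← Category.assoc, hμ, ← flatMul_flatMap, Category.assoc,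
      Category.assoc, hq.w]
  obtain ⟨P, π, hπ⟩ := exists_quotient (free (coprod.desc X.δ Y.δ)) hq (𝟙 _) _ hf hg hact
    (coproduct_relations X.toBase Y.toBase)
  exact ⟨P, Hom.hom π, hπ, Hom.comp_δ π, Hom.act_comp π⟩

/-- Pre-crossed modules have binary coproducts: `X +_PX Y` is the quotient of the free pre-crossed
module on `[δ_X, δ_Y] : X + Y ⟶ B` which forces both injections to be equivariant. -/
theorem exists_coproduct {B : C} (X Y : PXMod B) :
    ∃ c : BinaryCofan X Y, Nonempty (IsColimit c) := by
  obtain ⟨P, π, hπ, hδ, hact⟩ := exists_coproduct_presentation X Y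
  have := hπ.isRegularEpi
  -- A morphism from a pre-crossed module to `X + Y` over `B` becomes one of pre-crossed modules in
  -- `P` as soon as the relations imposed by `π` make it equivariant.
  have hη : ∀ {Z : PXMod B} (a : Z.obj ⟶ X.obj ⨿ Y.obj)
      (_ : a ≫ coprod.desc X.δ Y.δ = Z.δ) (_ : Z.act ≫ a ≫ flatUnit B _ ≫ π =
        flatMap (𝟙 B) a ≫ π),
      ∃ a' : Z ⟶ P, Hom.hom a' = a ≫ flatUnit B _ ≫ π := by
    intro Z a ha h
    refine ⟨⟨a ≫ flatUnit B _ ≫ π, ?_, ?_⟩, rfl⟩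
    · rw [Category.assoc, Category.assoc, hδ, ← ha, ← Category.assoc (flatUnit B _),
        flatUnit_flatMap, Category.assoc, (isAction_conj B).unit, Category.comp_id]
    · rw [h]
      conv_lhs => rw [eq_flatMap_act π hact]
      rw [← Category.assoc, flatMap_comp, Category.comp_id]
  have hw : coprod.map X.act Y.act ≫ flatUnit B _ ≫ π = flatCoprod B X.obj Y.obj ≫ π := by
    have := flatUnit B _ ≫= hπ.w
    simp only [← Category.assoc] at this
    rw [flatUnit_flatMap, flatUnit_flatMap, Category.assoc _ (flatUnit B _) (flatMul B _),
      flatUnit_flatMul, Category.comp_id] at this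
    rw [← this, Category.assoc]
  obtain ⟨l, hl⟩ := hη (Z := X) coprod.inl (by simp) (by
    simpa [flatCoprod] using coprod.inl ≫= hw)
  obtain ⟨m, hm⟩ := hη (Z := Y) coprod.inr (by simp) (by
    simpa [flatCoprod] using coprod.inr ≫= hw)
  have exists_desc : ∀ {N : PXMod B} (h : X ⟶ N) (k : Y ⟶ N),
      ∃ u : P ⟶ N, l ≫ u = h ∧ m ≫ u = k := by
    intro N h k
    obtain ⟨u, hu⟩ := hπ.exists_desc _ (coproduct_relations h k)
    have hu' : flatUnit B _ ≫ π ≫ u = coprod.desc (Hom.hom h) (Hom.hom k) := by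
      rw [hu, ← Category.assoc, flatUnit_flatMap, Category.assoc, N.act_unit, Category.comp_id]
    refine ⟨⟨u, ?_, ?_⟩, hom_ext ?_, hom_ext ?_⟩
    · rw [← cancel_epi π, ← Category.assoc, hu, hδ, Category.assoc, N.precrossed,
        ← Category.assoc, flatMap_comp, Category.comp_id]
      congr 2
      ext <;> simp [Hom.comp_δ]
    · rw [← cancel_epi (flatMap (𝟙 B) π), ← Category.assoc, ← hact, Category.assoc, hu,
        flatMul_flatMap_act, ← Category.assoc, flatMap_comp, hu, Category.comp_id]
    · rw [comp_hom, hl, Category.assoc, Category.assoc, hu', coprod.inl_desc]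
    · rw [comp_hom, hm, Category.assoc, Category.assoc, hu', coprod.inr_desc]
  choose desc hdl hdm using @exists_desc
  have huniq : ∀ {N : PXMod B} (v w : P ⟶ N), l ≫ v = l ≫ w → m ≫ v = m ≫ w → v = w := by
    intro N v w h₁ h₂
    have h₁' := congr(Hom.hom $h₁)
    have h₂' := congr(Hom.hom $h₂)
    simp only [comp_hom, hl, hm, Category.assoc] at h₁' h₂'
    have equiv : ∀ v : P ⟶ N, flatMul B _ ≫ π ≫ Hom.hom v =
        flatMap (𝟙 B) (π ≫ Hom.hom v) ≫ N.act := by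
      intro v
      rw [← Category.assoc, hact, Category.assoc, Hom.act_comp, ← Category.assoc, flatMap_comp,
        Category.comp_id]
    apply hom_ext
    rw [← cancel_epi π, eq_flatMap_act _ (equiv v), eq_flatMap_act _ (equiv w),
      coprod.hom_ext h₁' h₂']
  exact ⟨BinaryCofan.mk l m, ⟨BinaryCofan.isColimitMk (fun s ↦ desc s.inl s.inr)
    (fun s ↦ hdl _ _) (fun s ↦ hdm _ _) fun s u hul hum ↦
      huniq _ _ (hul.trans (hdl _ _).symm) (hum.trans (hdm _ _).symm)⟩⟩

/-! ### Pushouts of regular epimorphisms of pre-crossed modules -/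

/-- Pushouts of regular epimorphisms of pre-crossed modules exist and are computed in `C`. -/
theorem exists_isPushout {B : C} {U S T : PXMod B} (f : U ⟶ S) (g : U ⟶ T)
    [IsRegularEpi (Hom.hom f)] [IsRegularEpi (Hom.hom g)] :
    ∃ (P : PXMod B) (l : S ⟶ P) (r : T ⟶ P), IsPushout f g l r ∧
      IsPushout (Hom.hom f) (Hom.hom g) (Hom.hom l) (Hom.hom r) := by
  let p₁ := pullback.fst (Hom.hom g) (Hom.hom g)
  let p₂ := pullback.snd (Hom.hom g) (Hom.hom g)
  have hp : p₁ ≫ Hom.hom g = p₂ ≫ Hom.hom g := pullback.condition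
  let d := pullback.lift (f := Hom.hom g) (g := Hom.hom g) (𝟙 U.obj) (𝟙 U.obj) rfl
  have hd₁ : d ≫ p₁ ≫ Hom.hom f = Hom.hom f := by simp [d, p₁]
  have hd₂ : d ≫ p₂ ≫ Hom.hom f = Hom.hom f := by simp [d, p₂]
  obtain ⟨Q, q, hq⟩ := exists_isExactFork (p₁ ≫ Hom.hom f) (p₂ ≫ Hom.hom f) (Hom.hom f) d hd₁ hd₂
  -- The kernel pair of `g` is stable under the action of `B`.
  let α := pullback.lift (f := Hom.hom g) (g := Hom.hom g) (flatMap (𝟙 B) p₁ ≫ U.act)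
    (flatMap (𝟙 B) p₂ ≫ U.act) (by
      rw [Category.assoc, Category.assoc, Hom.act_comp, ← Category.assoc, ← Category.assoc,
        flatMap_comp, flatMap_comp, hp])
  have hα : ∀ p : pullback (Hom.hom g) (Hom.hom g) ⟶ U.obj, α ≫ p = flatMap (𝟙 B) p ≫ U.act →
      flatMap (𝟙 B) (p ≫ Hom.hom f) ≫ S.act = α ≫ p ≫ Hom.hom f := by
    intro p hp
    rw [← Category.assoc α, hp, Category.assoc, Hom.act_comp, ← Category.assoc, flatMap_comp,
      Category.comp_id]
  obtain ⟨P, l, hl⟩ := exists_quotient S hq (Hom.hom f) d hd₁ hd₂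
    (by
      rw [← Category.assoc, ← Category.assoc, hα p₁ (by simp [α, p₁]), hα p₂ (by simp [α, p₂]),
        Category.assoc α, Category.assoc α, hq.w])
    (by
      rw [Category.assoc, Category.assoc, Hom.comp_δ, ← Hom.comp_δ g, ← Category.assoc, hp,
        Category.assoc])
  have := hl.isRegularEpi
  have hdesc : ∀ {Z : C} (k : U.obj ⟶ Z), p₁ ≫ k = p₂ ≫ k → ∃ k', Hom.hom g ≫ k' = k :=
    fun k hk ↦ IsRegularEpi.exists_of_isKernelPair _ (IsKernelPair.of_hasPullback _) k hk
  obtain ⟨r, hr⟩ := hdesc (Hom.hom f ≫ Hom.hom l) (by simpa using hl.w)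
  obtain ⟨r, rfl, hr'⟩ := exists_hom_of_isRegularEpi g (f ≫ l) r hr
  have exists_desc : ∀ {Z : C} (a : S.obj ⟶ Z) (b : T.obj ⟶ Z)
      (_ : Hom.hom f ≫ a = Hom.hom g ≫ b), ∃ k, Hom.hom l ≫ k = a ∧ Hom.hom r ≫ k = b := by
    intro Z a b hab
    obtain ⟨k, hk⟩ := hl.exists_desc a (by
      rw [Category.assoc, Category.assoc, hab, ← Category.assoc, hp, Category.assoc])
    refine ⟨k, hk, ?_⟩
    rw [← cancel_epi (Hom.hom g), ← Category.assoc, hr, Category.assoc, hk, hab]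
  refine ⟨P, l, r, ?_, ?_⟩
  · have exists_desc' : ∀ s : PushoutCocone f g, ∃ k : P ⟶ s.pt, l ≫ k = s.inl ∧ r ≫ k = s.inr := by
      intro s
      obtain ⟨k, hk₁, hk₂⟩ := exists_desc (Hom.hom s.inl) (Hom.hom s.inr)
        congr(Hom.hom $s.condition)
      obtain ⟨k, rfl, hk⟩ := exists_hom_of_isRegularEpi l s.inl k hk₁
      exact ⟨k, hk, hom_ext hk₂⟩
    choose desc h₁ h₂ using exists_desc'
    exact ⟨⟨hr'.symm⟩, ⟨PushoutCocone.IsColimit.mk _ desc h₁ h₂ fun s m hm _ ↦ hom_ext (by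
      rw [← cancel_epi (Hom.hom l), ← comp_hom, ← comp_hom, hm, h₁])⟩⟩
  · choose desc h₁ h₂ using fun s : PushoutCocone (Hom.hom f) (Hom.hom g) ↦
      exists_desc s.inl s.inr s.condition
    exact ⟨⟨hr.symm⟩, ⟨PushoutCocone.IsColimit.mk _ desc h₁ h₂ fun s m hm _ ↦ by
      rw [← cancel_epi (Hom.hom l), hm, h₁]⟩⟩

theorem isPushout_hom {B : C} {U S T P : PXMod B} {f : U ⟶ S} {g : U ⟶ T} {l : S ⟶ P}
    {r : T ⟶ P} [IsRegularEpi (Hom.hom f)] [IsRegularEpi (Hom.hom g)] (h : IsPushout f g l r) :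
    IsPushout (Hom.hom f) (Hom.hom g) (Hom.hom l) (Hom.hom r) := by
  obtain ⟨P', l', r', h', hC⟩ := exists_isPushout f g
  exact hC.of_iso (Iso.refl _) (Iso.refl _) (Iso.refl _)
    ((forget B).mapIso (h'.isoIsPushout _ _ h)) (by simp) (by simp)
    (by simp [← comp_hom]) (by simp [← comp_hom])

end PXMod

/-! ### Semidirect products -/

theorem isIso_of_isKer {E E' B K : C} {p : E ⟶ B} {s : B ⟶ E} {p' : E' ⟶ B} {s' : B ⟶ E'}
    {t : E ⟶ E'} {k : K ⟶ E} (hs : s ≫ p = 𝟙 B) (hs' : s' ≫ p' = 𝟙 B) (hp : t ≫ p' = p)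
    (ht : s ≫ t = s') (hk : IsKer k p) (hk' : IsKer (k ≫ t) p') : IsIso t := by
  have := hk.mono
  have := hk'.mono
  obtain ⟨l, hl⟩ := hk'.exists_lift (kernel.ι p') (kernel.condition p')
  obtain ⟨m, hm⟩ := hk.exists_lift (kernel.ι p) (kernel.condition p)
  have hml : kernel.map p p' t (𝟙 B) (by simp [hp]) ≫ l = m := by
    rw [← cancel_mono (k ≫ t), Category.assoc, hl, reassoc_of% hm]
    simp
  refine SemiAbelian.splitShortFive p s p' s' t hs hs' (by simp [hp]) ht
    ⟨kernel.lift p (l ≫ k) (by rw [Category.assoc, hk.w, comp_zero]), ?_, ?_⟩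
  · rw [← cancel_mono (kernel.ι p), Category.assoc, kernel.lift_ι, ← Category.assoc, hml, hm,
      Category.id_comp]
  · rw [← cancel_mono (kernel.ι p'), Category.assoc, kernel.map, kernel.lift_ι,
      kernel.lift_ι_assoc, Category.assoc, hl, Category.id_comp]

section

variable {G X S : C} {ξ : flat G X ⟶ X} {j : X ⟶ S} {i : G ⟶ S}

theorem IsSemidirect.w (h : IsSemidirect ξ j i) : flatι G X ≫ coprod.desc i j = ξ ≫ j :=
  CommSq.w (IsPushout.toCommSq h)

theorem IsSemidirect.exists_desc (h : IsSemidirect ξ j i) {Z : C} (a : G ⟶ Z) (b : X ⟶ Z)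
    (w : flatι G X ≫ coprod.desc a b = ξ ≫ b) : ∃ u : S ⟶ Z, i ≫ u = a ∧ j ≫ u = b :=
  ⟨IsPushout.desc h (coprod.desc a b) b w, by
    simpa using coprod.inl ≫= IsPushout.inl_desc h (coprod.desc a b) b w,
    IsPushout.inr_desc h _ _ _⟩

theorem IsSemidirect.hom_ext (h : IsSemidirect ξ j i) {Z : C} {u v : S ⟶ Z}
    (hi : i ≫ u = i ≫ v) (hj : j ≫ u = j ≫ v) : u = v :=
  IsPushout.hom_ext h (by ext <;> simp [hi, hj]) hj

/-- The semidirect product is a quotient of the coproduct. -/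
theorem IsSemidirect.isRegularEpi (h : IsSemidirect ξ j i) :
    IsRegularEpi (coprod.desc i j) := by
  have key : ∀ {Z : C} (k : G ⨿ X ⟶ Z), flatι G X ≫ k = (ξ ≫ coprod.inr) ≫ k →
      ∃ u, coprod.desc i j ≫ u = k := by
    intro Z k hk
    have e : coprod.desc (coprod.inl ≫ k) (coprod.inr ≫ k) = k := by ext <;> simp
    obtain ⟨u, hi, hj⟩ := h.exists_desc (coprod.inl ≫ k) (coprod.inr ≫ k)
      (by rw [e, hk, Category.assoc])
    exact ⟨u, by ext <;> simp [hi, hj]⟩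
  choose desc hdesc using @key
  have : Epi (coprod.desc i j) := ⟨fun u v huv ↦ h.hom_ext
    (by simpa using coprod.inl ≫= huv) (by simpa using coprod.inr ≫= huv)⟩
  exact ⟨⟨{
    W := flat G X
    left := flatι G X
    right := ξ ≫ coprod.inr
    w := by simp [h.w]
    isColimit := Cofork.IsColimit.mk _ (fun s ↦ desc s.π s.condition) (fun s ↦ hdesc _ _)
      fun s m hm ↦ by rw [← cancel_epi (coprod.desc i j), hdesc]; exact hm }⟩⟩

/-- Every action has a semidirect product, and this is a split extension: `j` is the kernel of the
projection to `G`. Indeed `X ⋊ G` is the exact quotient of `G + (G ♭ X) ⇉ G + X`; on kernels over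
`G` this restricts to the quotient of `G ♭ (G ♭ X) ⇉ G ♭ X`, which is `X`. -/
theorem IsAction.exists_isSemidirect (hξ : IsAction ξ) :
    ∃ (S : C) (j : X ⟶ S) (i : G ⟶ S) (p : S ⟶ G), IsSemidirect ξ j i ∧ i ≫ p = 𝟙 G ∧
      IsKer j p := by
  let f : G ⨿ flat G X ⟶ G ⨿ X := coprod.map (𝟙 G) ξ
  let g : G ⨿ flat G X ⟶ G ⨿ X := coprod.desc coprod.inl (flatι G X)
  obtain ⟨S, q, hq⟩ := exists_isExactFork f g (𝟙 _) (coprod.map (𝟙 G) (flatUnit G X))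
    (by ext <;> simp [f, hξ.unit]) (by ext <;> simp [g])
  have := hq.isRegularEpi
  have hg : g ≫ coprod.desc (𝟙 G) 0 = coprod.desc (𝟙 G) (0 : flat G X ⟶ G) := by
    ext <;> simp [g, flatι_desc]
  obtain ⟨p, hp⟩ := hq.exists_desc (coprod.desc (𝟙 G) 0) (by
    rw [hg]
    ext <;> simp [f])
  have hker : (flatι G X ≫ q) ≫ p = 0 := by rw [Category.assoc, hp, flatι_desc]
  let q' : flat G X ⟶ kernel p := kernel.lift p (flatι G X ≫ q) hker
  have hq' : q' ≫ kernel.ι p = flatι G X ≫ q := kernel.lift_ι _ _ _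
  have hqX : IsExactFork (flatMap (𝟙 G) ξ) (flatMul G X) q' :=
    hq.of_isPullback ((isKer_flatι G X).isPullback (isKer_kernel p) hp hq'.symm)
      (isPullback_flatMap G ξ) (flatMul_ι G X).symm
  have := hqX.isRegularEpi
  obtain ⟨u, hu⟩ := hqX.exists_desc ξ hξ.mul.symm
  -- Both `q'` and `ξ` are coequalizers of `G ♭ ξ` and the multiplication.
  have : IsIso (flatUnit G X ≫ q') := by
    refine ⟨u, by rw [Category.assoc, hu, hξ.unit], ?_⟩
    rw [← cancel_epi q', ← Category.assoc, hu, ← Category.assoc, ← flatUnit_flatMap (𝟙 G),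
      Category.assoc, hqX.w, ← Category.assoc, flatUnit_flatMul, Category.id_comp,
      Category.comp_id]
  have hj : (flatUnit G X ≫ q') ≫ kernel.ι p = coprod.inr ≫ q := by
    rw [Category.assoc, hq', ← Category.assoc, flatUnit_ι]
  have hdesc : coprod.desc (coprod.inl ≫ q) (coprod.inr ≫ q) = q := by ext <;> simp
  have hw : flatι G X ≫ q = ξ ≫ coprod.inr ≫ q := by
    simpa [f, g] using (coprod.inr ≫= hq.w).symm
  have key : ∀ s : PushoutCocone (flatι G X) ξ, coprod.inr ≫ s.inl = s.inr ∧
      ∃ l, q ≫ l = s.inl := by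
    intro s
    have h : coprod.inr ≫ s.inl = s.inr := by
      rw [← flatUnit_ι G X, Category.assoc, s.condition, ← Category.assoc, hξ.unit,
        Category.id_comp]
    exact ⟨h, hq.exists_desc s.inl (by
      ext
      · simp [f, g]
      · simp [f, g, h, s.condition])⟩
  choose hinr desc hd using key
  refine ⟨S, coprod.inr ≫ q, coprod.inl ≫ q, p, ?_, by simp [hp],
    hj ▸ (isKer_kernel p).of_iso _⟩
  refine ⟨⟨by rw [hdesc, hw]⟩, ⟨PushoutCocone.IsColimit.mk _ desc (fun s ↦ by rw [hdesc, hd])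
    (fun s ↦ by rw [Category.assoc, hd, hinr]) fun s m hm _ ↦ ?_⟩⟩
  rw [← cancel_epi q, hd, ← hm, hdesc]

end

/-- The semidirect product of pre-crossed modules exists. The square comparing `X ⋊ Y ⟶ Y` with
`X ⋊ B ⟶ B` is a pullback since both split extensions have kernel `X`; hence morphisms to `X ⋊ Y`,
and identities between them, are given by their components in `Y` and `X ⋊ B`. -/
theorem nonempty_semidirectPXMod {B : C} (X Y : PXMod B) : Nonempty (SemidirectPXMod X Y) := by
  obtain ⟨W, jW, iB, pB, hW, hiB, hjW⟩ := X.isAction.exists_isSemidirect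
  obtain ⟨S, j, i, pY, hS, hiY, hj⟩ := (isAction_inducedAct X Y).exists_isSemidirect
  have hact : ∀ {Z : C} (a : B ⟶ Z) (b : X.obj ⟶ Z),
      flatι B X.obj ≫ coprod.desc a b = X.act ≫ b →
        flatι Y.obj X.obj ≫ coprod.desc (Y.δ ≫ a) b = inducedAct X Y ≫ b := by
    intro Z a b h
    rw [inducedAct, Category.assoc, ← h, ← Category.assoc, flatMap_ι, Category.assoc]
    congr 1
    ext <;> simp
  obtain ⟨t, hit, hjt⟩ := hS.exists_desc (Y.δ ≫ iB) jW (hact iB jW hW.w)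
  obtain ⟨δW, hδi, hδj⟩ := hW.exists_desc (𝟙 B) X.δ (by rw [X.precrossed, flatMap_conj])
  have ht : t ≫ pB = pY ≫ Y.δ := hS.hom_ext
    (by rw [reassoc_of% hit, hiB, reassoc_of% hiY, Category.comp_id])
    (by rw [reassoc_of% hjt, hjW.w, reassoc_of% hj.w, zero_comp])
  -- Both `X ⋊ Y` and `(X ⋊ B) ×_B Y` are split extensions of `Y` with kernel `X`.
  have hτ : IsIso (pullback.lift t pY ht) := by
    refine isIso_of_isKer (s' := pullback.lift (Y.δ ≫ iB) (𝟙 _) (by simp [hiB]))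
      (p' := pullback.snd pB Y.δ) hiY (by simp) (by simp) ?_ hj ?_
    · apply pullback.hom_ext <;> simp [hit, hiY]
    · have h₁ : (j ≫ pullback.lift t pY ht) ≫ pullback.fst pB Y.δ = jW := by simp [hjt]
      have := hjW.mono
      refine ⟨⟨fun a b hab ↦ ?_⟩, by simp [hj.w], fun x hx ↦ ?_⟩
      · rw [← cancel_mono jW, ← h₁, ← Category.assoc, hab, Category.assoc]
      · obtain ⟨l, hl⟩ := hjW.exists_lift (x ≫ pullback.fst pB Y.δ) (by
          rw [Category.assoc, pullback.condition, reassoc_of% hx, zero_comp])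
        refine ⟨l, ?_⟩
        apply pullback.hom_ext
        · rw [Category.assoc, h₁, hl]
        · simp [hj.w, hx]
  have sq : IsPullback t pY pB Y.δ := IsPullback.of_iso_pullback ⟨ht⟩
    (asIso (pullback.lift t pY ht)) (by simp) (by simp)
  let wact : flat W S ⟶ S := sq.lift (flatMap (𝟙 W) t ≫ conj W) (flatMap pB pY ≫ Y.act) (by
    rw [Category.assoc, conj_comp, ← Category.assoc, flatMap_comp, Category.assoc, Y.precrossed,
      ← Category.assoc, flatMap_comp, ht]
    simp)
  have hwt : wact ≫ t = flatMap (𝟙 W) t ≫ conj W := sq.lift_fst _ _ _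
  have hwY : wact ≫ pY = flatMap pB pY ≫ Y.act := sq.lift_snd _ _ _
  have hat : (flatMap iB (𝟙 S) ≫ wact) ≫ t =
      flatMap (𝟙 B) t ≫ flatMap iB (𝟙 W) ≫ conj W := by
    rw [Category.assoc, hwt, ← Category.assoc, ← Category.assoc, flatMap_comp, flatMap_comp]
    simp
  have haY : (flatMap iB (𝟙 S) ≫ wact) ≫ pY = flatMap (𝟙 B) pY ≫ Y.act := by
    rw [Category.assoc, hwY, ← Category.assoc, flatMap_comp, hiB, Category.id_comp]
  have hS' : IsAction (flatMap iB (𝟙 S) ≫ wact) :=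
    isAction_of_jointlyMono ((isAction_conj W).restrict iB) Y.isAction t pY
      (fun a b h₁ h₂ ↦ sq.hom_ext h₁ h₂) hat haY
  have hWconj : ∀ {Z : C} (z : Z ⟶ W), flatMap (𝟙 B) z ≫ flatMap iB (𝟙 W) ≫ conj W =
      flatMap iB z ≫ conj W := by
    intro Z z
    rw [← Category.assoc, flatMap_comp, Category.id_comp, Category.comp_id]
  -- The structure morphism is the composite of `1 ⋊ δ_Y` and `[δ_X, 1] : X ⋊ B ⟶ B`, so that its
  -- equivariance follows from the naturality of conjugation.
  let S' : PXMod B := ⟨S, t ≫ δW, flatMap iB (𝟙 S) ≫ wact, hS'.unit, hS'.mul, by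
    rw [← Category.assoc, hat, hWconj, Category.assoc, conj_comp, ← Category.assoc,
      flatMap_comp, hδi]⟩
  exact ⟨{
    S := S'
    j := ⟨j, by change j ≫ t ≫ δW = _; rw [reassoc_of% hjt, hδj], by
      refine sq.hom_ext ?_ ?_
      · rw [Category.assoc, Category.assoc, hat, ← Category.assoc (flatMap _ _), flatMap_comp,
          hjt, Category.id_comp, hWconj, flatMap_conj, hW.w]
      · rw [Category.assoc, Category.assoc, haY, hj.w, ← Category.assoc (flatMap _ _),
          flatMap_comp, hj.w, Category.id_comp, flatMap_zero, zero_comp, comp_zero]⟩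
    i := ⟨i, by change i ≫ t ≫ δW = _; rw [reassoc_of% hit, hδi, Category.comp_id], by
      refine sq.hom_ext ?_ ?_
      · rw [Category.assoc, Category.assoc, hat, ← Category.assoc (flatMap _ _), flatMap_comp,
          hit, Category.id_comp, hWconj, ← Category.assoc, Y.precrossed, Category.assoc,
          conj_comp, ← Category.assoc, flatMap_comp, Category.id_comp]
      · rw [Category.assoc, Category.assoc, haY, hiY, ← Category.assoc (flatMap _ _),
          flatMap_comp, hiY, Category.id_comp, flatMap_id, Category.id_comp, Category.comp_id]⟩
    isSemidirect := hS
    pY := pY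
    j_pY := hj.w
    i_pY := hiY
    W := W
    jW := jW
    iB := iB
    isSemidirectW := hW
    pB := pB
    jW_pB := hjW.w
    iB_pB := hiB
    t := t
    j_t := hjt
    i_t := hit
    wact := wact
    wact_pY := hwY
    wact_t := hwt
    act_eq := rfl }⟩

/-! ### Peiffer products -/

theorem PXMod.desc_comp_hom {B : C} {X Y U S : PXMod B} {a : X ⟶ U} {b : Y ⟶ U} {f : U ⟶ S}
    {a' : X ⟶ S} {b' : Y ⟶ S} (ha : a ≫ f = a') (hb : b ≫ f = b') :
    coprod.desc (Hom.hom a) (Hom.hom b) ≫ Hom.hom f = coprod.desc (Hom.hom a') (Hom.hom b') := by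
  subst ha hb
  ext <;> simp

theorem PXMod.isRegularEpi_hom_of_desc {B : C} {X Y U S : PXMod B} {a : X ⟶ U} {b : Y ⟶ U}
    {f : U ⟶ S} {a' : X ⟶ S} {b' : Y ⟶ S} (ha : a ≫ f = a') (hb : b ≫ f = b')
    (h : IsRegularEpi (coprod.desc (Hom.hom a') (Hom.hom b'))) : IsRegularEpi (Hom.hom f) := by
  rw [← desc_comp_hom ha hb] at h
  exact isRegularEpi_of_comp (coprod.desc (Hom.hom a) (Hom.hom b)) (Hom.hom f)

namespace PeifferProduct

open PXMod

variable {B : C} {X Y : PXMod B} (D : PeifferProduct X Y)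

/-- The canonical morphism from the coproduct of `X` and `Y` in `C` to their coproduct as
pre-crossed modules. -/
noncomputable def comparison : X.obj ⨿ Y.obj ⟶ D.coproduct.pt.obj :=
  coprod.desc (Hom.hom D.coproduct.inl) (Hom.hom D.coproduct.inr)

/-- The canonical morphism `[j_X, i_Y] : X + Y ⟶ X ⋊ Y`. -/
noncomputable def projLeft : X.obj ⨿ Y.obj ⟶ D.left.S.obj :=
  coprod.desc (Hom.hom D.left.j) (Hom.hom D.left.i)

/-- The canonical morphism `[i_X, j_Y] : X + Y ⟶ Y ⋊ X`. -/
noncomputable def projRight : X.obj ⨿ Y.obj ⟶ D.right.S.obj :=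
  coprod.desc (Hom.hom D.right.i) (Hom.hom D.right.j)

theorem comparison_toLeft : D.comparison ≫ Hom.hom D.toLeft = D.projLeft :=
  desc_comp_hom D.inl_toLeft D.inr_toLeft

theorem comparison_toRight : D.comparison ≫ Hom.hom D.toRight = D.projRight :=
  desc_comp_hom D.inl_toRight D.inr_toRight

theorem proj_eq : D.proj = D.projLeft ≫ Hom.hom D.fromLeft := by
  rw [← comparison_toLeft, Category.assoc]
  exact (desc_comp_hom rfl rfl).symm

theorem swap_projLeft : coprod.desc coprod.inr coprod.inl ≫ D.projLeft =
    coprod.desc (Hom.hom D.left.i) (Hom.hom D.left.j) := by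
  ext <;> simp [projLeft]

instance isRegularEpi_projLeft : IsRegularEpi D.projLeft := by
  have h := D.left.isSemidirect.isRegularEpi
  rw [← swap_projLeft] at h
  exact isRegularEpi_of_comp (coprod.desc coprod.inr coprod.inl) D.projLeft

instance isRegularEpi_projRight : IsRegularEpi D.projRight :=
  D.right.isSemidirect.isRegularEpi

theorem projLeft_conj : (flatι Y.obj X.obj ≫ coprod.desc coprod.inr coprod.inl) ≫ D.projLeft =
    (inducedAct X Y ≫ coprod.inl) ≫ D.projLeft := by
  rw [Category.assoc, swap_projLeft, D.left.isSemidirect.w, Category.assoc, projLeft,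
    coprod.inl_desc]

theorem projRight_conj :
    flatι X.obj Y.obj ≫ D.projRight = (inducedAct Y X ≫ coprod.inr) ≫ D.projRight := by
  rw [projRight, D.right.isSemidirect.w, Category.assoc, coprod.inr_desc]

theorem exists_desc_projLeft {Z : C} (h : X.obj ⨿ Y.obj ⟶ Z)
    (w : (flatι Y.obj X.obj ≫ coprod.desc coprod.inr coprod.inl) ≫ h =
      (inducedAct X Y ≫ coprod.inl) ≫ h) : ∃ u, D.projLeft ≫ u = h := by
  obtain ⟨u, hi, hj⟩ := D.left.isSemidirect.exists_desc (coprod.inr ≫ h) (coprod.inl ≫ h) (by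
    rw [← Category.assoc (inducedAct X Y), ← w, Category.assoc]
    congr 1
    ext <;> simp)
  exact ⟨u, by ext <;> simp [projLeft, hi, hj]⟩

theorem exists_desc_projRight {Z : C} (h : X.obj ⨿ Y.obj ⟶ Z)
    (w : flatι X.obj Y.obj ≫ h = (inducedAct Y X ≫ coprod.inr) ≫ h) :
    ∃ u, D.projRight ≫ u = h := by
  obtain ⟨u, hi, hj⟩ := D.right.isSemidirect.exists_desc (coprod.inl ≫ h) (coprod.inr ≫ h) (by
    rw [← Category.assoc (inducedAct Y X), ← w]
    congr 1
    ext <;> simp)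
  exact ⟨u, by ext <;> simp [projRight, hi, hj]⟩

/-- Under (CS), the Peiffer product is the pushout in `C` of the two quotients `X ⋊ Y` and `Y ⋊ X`
of `X + Y`: the pushout of pre-crossed modules is computed in `C`, and `X + Y` may replace the
coproduct of pre-crossed modules since the comparison is epic. -/
theorem isPushout_proj (hCS : ConditionCS C) :
    IsPushout D.projLeft D.projRight (Hom.hom D.fromLeft) (Hom.hom D.fromRight) := by
  have hσ : IsRegularEpi D.comparison := hCS B X Y D.coproduct D.isColimit
  have := isRegularEpi_hom_of_desc D.inl_toLeft D.inr_toLeft D.isRegularEpi_projLeft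
  have := isRegularEpi_hom_of_desc D.inl_toRight D.inr_toRight D.isRegularEpi_projRight
  have h := isPushout_hom D.isPushout
  rw [← comparison_toLeft, ← comparison_toRight]
  refine ⟨⟨by simp only [Category.assoc, h.w]⟩, ⟨PushoutCocone.IsColimit.mk _
    (fun s ↦ h.desc s.inl s.inr ?_) (fun s ↦ h.inl_desc _ _ _) (fun s ↦ h.inr_desc _ _ _)
    fun s m h₁ h₂ ↦ h.hom_ext (by rw [h₁, h.inl_desc]) (by rw [h₂, h.inr_desc])⟩⟩
  rw [← cancel_epi D.comparison]
  simpa using s.condition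

theorem isRegularEpi_proj (hCS : ConditionCS C) : IsRegularEpi D.proj := by
  have := (isExactFork_of_isPushout (D.isPushout_proj hCS)).isRegularEpi
  rw [proj_eq]
  exact isRegularEpi_comp _ _

theorem actionsBecomeConj_proj (hCS : ConditionCS C) : ActionsBecomeConj X Y D.proj := by
  constructor
  · rw [proj_eq, ← Category.assoc, projLeft_conj, Category.assoc]
  · rw [proj_eq, (D.isPushout_proj hCS).w, ← Category.assoc, projRight_conj, Category.assoc]

theorem exists_desc_proj (hCS : ConditionCS C) {Z : C} (u : D.left.S.obj ⟶ Z)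
    (v : D.right.S.obj ⟶ Z) (h : D.projLeft ≫ u = D.projRight ≫ v) :
    ∃ h', D.proj ≫ h' = D.projLeft ≫ u :=
  ⟨(D.isPushout_proj hCS).desc u v h, by
    rw [proj_eq, Category.assoc, (D.isPushout_proj hCS).inl_desc]⟩

theorem kernelJoin_eq :
    D.kernelJoin = kernelSubobject D.projLeft ⊔ kernelSubobject D.projRight := rfl

theorem kernelSubobject_proj (hCS : ConditionCS C) :
    kernelSubobject D.proj = D.kernelJoin := by
  rw [kernelJoin_eq]
  refine le_antisymm ?_ (sup_le ?_ ?_)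
  · obtain ⟨a, ha⟩ := exists_factor_kernel_of_isPushout (D.isPushout_proj hCS)
      (kernelSubobject D.projLeft ⊔ kernelSubobject D.projRight).arrow
      ⟨(kernelSubobjectIso D.projLeft).inv ≫ Subobject.ofLE _ _ le_sup_left, by simp⟩
      ⟨(kernelSubobjectIso D.projRight).inv ≫ Subobject.ofLE _ _ le_sup_right, by simp⟩
    rw [proj_eq]
    exact Subobject.mk_le_of_comm a ha
  · rw [proj_eq]
    exact kernelSubobject_comp_le _ _
  · rw [proj_eq, (D.isPushout_proj hCS).w]
    exact kernelSubobject_comp_le _ _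

theorem exists_isColimit_proj (hCS : ConditionCS C) :
    ∃ w : D.kernelJoin.arrow ≫ D.proj = 0,
      Nonempty (IsColimit (CokernelCofork.ofπ D.proj w)) := by
  rw [← D.kernelSubobject_proj hCS]
  have := D.isRegularEpi_proj hCS
  have key : ∀ {Z : C} (k : X.obj ⨿ Y.obj ⟶ Z) (_ : (kernelSubobject D.proj).arrow ≫ k = 0),
      ∃ l, D.proj ≫ l = k := fun k hk ↦ exists_desc_of_kernel D.proj k (by
    rw [← kernelSubobject_arrow', Category.assoc, hk, comp_zero])
  choose desc hdesc using @key
  exact ⟨kernelSubobject_arrow_comp _, ⟨CokernelCofork.IsColimit.ofπ _ _ (fun k hk ↦ desc k hk)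
    (fun k hk ↦ hdesc k hk) fun k hk m hm ↦ by rw [← cancel_epi D.proj, hm, hdesc]⟩⟩

theorem existsUnique_desc_proj (hCS : ConditionCS C) {Z : C} (h : X.obj ⨿ Y.obj ⟶ Z)
    (hh : ActionsBecomeConj X Y h) : ∃! h' : D.pt.obj ⟶ Z, D.proj ≫ h' = h := by
  have := D.isRegularEpi_proj hCS
  obtain ⟨u, hu⟩ := D.exists_desc_projLeft h hh.1
  obtain ⟨v, hv⟩ := D.exists_desc_projRight h hh.2
  obtain ⟨h', hh'⟩ := D.exists_desc_proj hCS u v (hu.trans hv.symm)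
  exact ⟨h', hh'.trans hu, fun k hk ↦ by rw [← cancel_epi D.proj, hk, hh', hu]⟩

end PeifferProduct

/-- The two morphisms from the coproduct of pre-crossed modules to the semidirect products are
regular epimorphisms, so that their pushout exists. -/
theorem nonempty_peifferProduct {B : C} (X Y : PXMod B) : Nonempty (PeifferProduct X Y) := by
  obtain ⟨c, ⟨hc⟩⟩ := PXMod.exists_coproduct X Y
  obtain ⟨L⟩ := nonempty_semidirectPXMod X Y
  obtain ⟨R⟩ := nonempty_semidirectPXMod Y X
  obtain ⟨f, hf₁, hf₂⟩ := BinaryCofan.IsColimit.desc' hc L.j L.i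
  obtain ⟨g, hg₁, hg₂⟩ := BinaryCofan.IsColimit.desc' hc R.i R.j
  have := PXMod.isRegularEpi_hom_of_desc hf₂ hf₁ L.isSemidirect.isRegularEpi
  have := PXMod.isRegularEpi_hom_of_desc hg₁ hg₂ R.isSemidirect.isRegularEpi
  obtain ⟨P, l, r, h, -⟩ := PXMod.exists_isPushout f g
  exact ⟨⟨c, hc, L, R, f, hf₁, hf₂, g, hg₁, hg₂, P, l, r, h⟩⟩

end Peiffer

open Peiffer
theorem mainTheorem6 {C : Type u} [Category.{v} C] [HasZeroMorphisms C] [SemiAbelian C]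
    (hCS : ConditionCS C) {B : C} (X Y : PXMod B) :
    Nonempty (PeifferProduct X Y) ∧
    ∀ D : PeifferProduct X Y,
      -- the quotient of `X + Y` by the join of the two kernels: a short exact sequence
      (IsRegularEpi D.proj ∧
        kernelSubobject D.proj = D.kernelJoin ∧
        ∃ w : D.kernelJoin.arrow ≫ D.proj = 0,
          Nonempty (IsColimit (CokernelCofork.ofπ D.proj w))) ∧
      -- the universal quotient of `X + Y` where both actions become conjugations
      (ActionsBecomeConj X Y D.proj ∧
        ∀ (Z : C) (h : X.obj ⨿ Y.obj ⟶ Z), ActionsBecomeConj X Y h →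
          ∃! h' : D.pt.obj ⟶ Z, D.proj ≫ h' = h) :=
  ⟨nonempty_peifferProduct X Y, fun D ↦
    ⟨⟨D.isRegularEpi_proj hCS, D.kernelSubobject_proj hCS, D.exists_isColimit_proj hCS⟩,
      D.actionsBecomeConj_proj hCS, fun _ h hh ↦ D.existsUnique_desc_proj hCS h hh⟩⟩
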